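/- Let $N\ge 0$, let $K$ be a field of characteristic $0$, and let $\alpha\in K$ not be a non-positive rational number (for example $\alpha$ an indeterminate, or a positive real number). Superpolynomials are the elements of $K[z_1,\dots,z_N]\otimes\bigwedge(\phi_1,\dots,\phi_N,\theta_1,\dots,\theta_N)$. For $\omega\in S_N$, $\mathcal K_\omega$ permutes the triples $(z_i,\phi_i,\theta_i)\mapsto(z_{\omega(i)},\phi_{\omega(i)},\theta_{\omega(i)})$, and $K_{ij}$ exchanges $z_i$ and $z_j$ only. Let $$\mathcal D_i=\alpha z_i\partial_{z_i}+\sum_{j<i}\frac{z_i}{z_i-z_j}(1-K_{ij})+\sum_{j>i}\frac{z_j}{z_i-z_j}(1-K_{ij})-(i-1).$$ *Non-symmetric Jack polynomials.* For $\eta\in\mathbb Z_{\ge0}^N$ let $\eta^+$ be its weakly decreasing rearrangement and $w_\eta\in S_N$ the permutation of minimal length with $\eta=w_\eta\eta^+$. Write $\nu\prec\eta$ if $\nu^+<\eta^+$ in the dominance order, or $\nu^+=\eta^+$ and $w_\nu>w_\eta$ in the Bruhat order. $E_\eta\in K[z_1,\dots,z_N]$ is the unique polynomial of the form $z^\eta+\sum_{\nu\prec\eta}a_{\eta,\nu}z^\nu$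 with $\mathcal D_iE_\eta=\widehat\eta_iE_\eta$ for all $i$, where $\widehat\eta_i=\alpha\eta_i-\#\{j<i:\eta_j\ge\eta_i\}-\#\{j>i:\eta_j>\eta_i\}$. *Sectors and superpartitions.* A sector is $M=(m_1,m_2,m_3)\in\mathbb Z_{\ge0}^3$ with $m_1+m_2+m_3\le N$; put $M_0=0$, $M_1=m_1$, $M_2=m_1+m_2$, $M_3=m_1+m_2+m_3$, let $S_M^{\mathrm{Y}}=S_{\{1,\dots,M_1\}}\times S_{\{M_1+1,\dots,M_2\}}\times S_{\{M_2+1,\dots,M_3\}}\times S_{\{M_3+1,\dots,N\}}$, and $$[\phi;\theta]_M=\prod_{i=1}^{M_1}\phi_i\theta_i\prod_{j=M_1+1}^{M_2}\phi_j\prod_{k=M_2+1}^{M_3}\theta_k .$$ $\mathcal P^M$ is the projector onto the terms $[\phi;\theta]_M f(z)$; it kills every other monomial in the anticommuting variables. A superpartition of length at most $N$ in the sector $M$ is $\Lambda=(\Lambda_1,\dots,\Lambda_{M_1};\Lambda_{M_1+1},\dots,\Lambda_{M_2};\Lambda_{M_2+1},\dots,\Lambda_{M_3};\Lambda_{M_3+1},\dots,\Lambda_N)\in\mathbb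 Z_{\ge 0}^N$ whose first and fourth blocks are weakly decreasing and whose second and third blocks are strictly decreasing (zeros of the fourth block are padding). $\Lambda^R$ is obtained by reversing each block; $\Lambda^{[k]}=(\Lambda+1^{M_k})^+$ for $k=0,1,2,3$, where $1^{m}=(1,\dots,1,0,\dots,0)$ with $m$ ones; and $f_\Lambda=\prod_{a\ge0}n_1(a)!\prod_{a\ge1}n_4(a)!$, where $n_b(a)$ is the multiplicity of $a$ in the $b$-th block. The Jack superpolynomial is $$P^{(\alpha)}_\Lambda=\frac{(-1)^{\binom{m_2}{2}+\binom{m_3}{2}}}{f_\Lambda}\sum_{\omega\in S_N}\mathcal K_\omega\,[\phi;\theta]_M\,E_{\Lambda^R}(z).$$ *Sekiguchi operators.* For $u\in K$ let $S^{[0]}(u,\alpha)=\prod_{i=1}^N(\mathcal D_i+u)$ and, for $k=1,2,3$, $$S^{[k]}(u,\alpha)=\sum_{M}\frac1{|S_M^{\mathrm{Y}}|}\sum_{\omega\in S_N}\mathcal K_\omega\,\mathcal P^M\prod_{i=1}^{M_k}(\mathcal D_i+\alpha+u)\prod_{j=M_k+1}^N(\mathcal D_j+u),$$ the sum being over all sectors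 $M$. **Proposition.** For every superpartition $\Lambda$ of length at most $N$, the polynomial $E_{\Lambda^R}$ exists and is unique, and $P^{(\alpha)}_\Lambda$ is a common eigenfunction of the four operators $S^{[k]}(u,\alpha)$: $P^{(\alpha)}_\Lambda\neq0$ and, for all $u\in K$ and $k=0,1,2,3$, $$S^{[k]}(u,\alpha)\,P^{(\alpha)}_\Lambda=\varepsilon_{\Lambda^{[k]}}(u,\alpha)\,P^{(\alpha)}_\Lambda,\qquad \varepsilon_\lambda(u,\alpha)=\prod_{i=1}^N(\alpha\lambda_i+1-i+u).$$ -/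

import Mathlib

open scoped TensorProduct

noncomputable section

namespace N2Jack

/-! ### Divided differences and the Dunkl operators -/

section Dunkl

variable {K : Type*} [Field K] {N : ℕ}

/-- The operator `K_ω` on polynomials in `z_1, …, z_N`, sending `z_i` to `z_{ω i}`. -/
def permZ (ω : Equiv.Perm (Fin N)) : MvPolynomial (Fin N) K →ₗ[K] MvPolynomial (Fin N) K :=
  (MvPolynomial.rename (R := K) ω).toLinearMap

theorem dvd_sub_swap (i j : Fin N) (f : MvPolynomial (Fin N) K) :
    (MvPolynomial.X i - MvPolynomial.X j : MvPolynomial (Fin N) K) ∣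
      f - permZ (Equiv.swap i j) f := by
  induction f using MvPolynomial.induction_on with
  | C a => simp [permZ]
  | add p q hp hq =>
    rw [map_add, add_sub_add_comm]
    exact dvd_add hp hq
  | mul_X p k hp =>
    have hX : (MvPolynomial.X i - MvPolynomial.X j : MvPolynomial (Fin N) K) ∣
        MvPolynomial.X k - MvPolynomial.X (Equiv.swap i j k) := by
      rcases eq_or_ne k i with rfl | hi
      · simp
      rcases eq_or_ne k j with rfl | hj
      · rw [Equiv.swap_apply_right, ← neg_sub]
        exact neg_dvd.mpr (dvd_refl _)
      · simp [Equiv.swap_apply_of_ne_of_ne hi hj]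
    have h : p * MvPolynomial.X k - permZ (Equiv.swap i j) (p * MvPolynomial.X k)
        = (p - permZ (Equiv.swap i j) p) * MvPolynomial.X k
          + permZ (Equiv.swap i j) p
            * (MvPolynomial.X k - MvPolynomial.X (Equiv.swap i j k)) := by
      simp only [permZ, AlgHom.toLinearMap_apply, map_mul, MvPolynomial.rename_X]
      ring
    rw [h]
    exact dvd_add (hp.mul_right _) (hX.mul_left _)

theorem X_sub_X_ne_zero {i j : Fin N} (h : i ≠ j) :
    (MvPolynomial.X i - MvPolynomial.X j : MvPolynomial (Fin N) K) ≠ 0 :=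
  sub_ne_zero.mpr fun e => h (MvPolynomial.X_injective e)

/-- The divided difference `f ↦ (1 / (z_i - z_j)) (1 - K_{ij}) f` for `i ≠ j`
(and zero, by convention, if `i = j`). -/
def divDiff (i j : Fin N) : MvPolynomial (Fin N) K →ₗ[K] MvPolynomial (Fin N) K where
  toFun f := if i = j then 0 else (dvd_sub_swap i j f).choose
  map_add' f g := by
    split_ifs with h
    · simp
    · apply mul_left_cancel₀ (X_sub_X_ne_zero (K := K) h)
      rw [mul_add, ← (dvd_sub_swap i j f).choose_spec, ← (dvd_sub_swap i j g).choose_spec,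
        ← (dvd_sub_swap i j (f + g)).choose_spec, map_add]
      ring
  map_smul' c f := by
    split_ifs with h
    · simp
    · apply mul_left_cancel₀ (X_sub_X_ne_zero (K := K) h)
      rw [RingHom.id_apply, mul_smul_comm, ← (dvd_sub_swap i j f).choose_spec,
        ← (dvd_sub_swap i j (c • f)).choose_spec, map_smul, smul_sub]

theorem X_sub_X_mul_divDiff {i j : Fin N} (h : i ≠ j) (f : MvPolynomial (Fin N) K) :
    (MvPolynomial.X i - MvPolynomial.X j) * divDiff i j f
      = f - permZ (Equiv.swap i j) f := by
  simp only [divDiff, LinearMap.coe_mk, AddHom.coe_mk, if_neg h]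
  exact (dvd_sub_swap i j f).choose_spec.symm

/-- Multiplication by the variable `z_i`. -/
def mulZ (i : Fin N) : Module.End K (MvPolynomial (Fin N) K) :=
  LinearMap.mulLeft K (MvPolynomial.X i)

/-- The Dunkl operator `𝒟_i`. Indices in `Fin N` start at `0`, so that the constant `i - 1` is
the value of `i : Fin N`. -/
def dunkl (α : K) (i : Fin N) : Module.End K (MvPolynomial (Fin N) K) :=
  α • (mulZ i ∘ₗ (MvPolynomial.pderiv (R := K) i).toLinearMap)
    + ∑ j ∈ Finset.univ.filter (fun j => j < i), mulZ i ∘ₗ divDiff i j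
    + ∑ j ∈ Finset.univ.filter (fun j => i < j), mulZ j ∘ₗ divDiff i j
    - ((i : ℕ) : K) • (1 : Module.End K (MvPolynomial (Fin N) K))

end Dunkl

/-! ### Orders on compositions -/

section Orders

variable {N : ℕ}

/-- `w_η`: the permutation of minimal length with `η = w_η η⁺`, that is, such that `η ∘ w_η` is
weakly decreasing. It is the stable sorting permutation; see `permLength_sortPerm_le` and
`eq_sortPerm_of_permLength_le`. -/
def sortPerm (η : Fin N → ℕ) : Equiv.Perm (Fin N) := Tuple.sort (OrderDual.toDual ∘ η)

/-- `η⁺`: the weakly decreasing rearrangement of the composition `η`. -/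
def plus (η : Fin N → ℕ) : Fin N → ℕ := η ∘ sortPerm η

theorem antitone_plus (η : Fin N → ℕ) : Antitone (plus η) :=
  Tuple.monotone_sort (OrderDual.toDual ∘ η)

/-- The length of a permutation: its number of inversions. -/
def permLength (w : Equiv.Perm (Fin N)) : ℕ :=
  (Finset.univ.filter fun p : Fin N × Fin N => p.1 < p.2 ∧ w p.2 < w p.1).card

/-- The strict Bruhat order `u < v` on the symmetric group: `v` is reached from `u` by a chain of
multiplications by transpositions, each of which increases the length. -/
def BruhatLT (u v : Equiv.Perm (Fin N)) : Prop :=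
  Relation.TransGen
    (fun x y => (∃ i j, y = Equiv.swap i j * x) ∧ permLength x < permLength y) u v

/-- The dominance order `μ ≤ lam` on partitions written as weakly decreasing `N`-tuples. -/
def DomLE (μ lam : Fin N → ℕ) : Prop :=
  ∑ i, μ i = ∑ i, lam i ∧
    ∀ k : ℕ, ∑ i ∈ Finset.univ.filter (fun i : Fin N => (i : ℕ) < k), μ i ≤
      ∑ i ∈ Finset.univ.filter (fun i : Fin N => (i : ℕ) < k), lam i

/-- The Bruhat order `ν ≺ η` on weak compositions. -/
def CompLT (ν η : Fin N → ℕ) : Prop :=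
  (DomLE (plus ν) (plus η) ∧ plus ν ≠ plus η) ∨
    (plus ν = plus η ∧ BruhatLT (sortPerm η) (sortPerm ν))

theorem sortPerm_lt_of_lt (η : Fin N → ℕ) {i j : Fin N} (hij : i < j)
    (h : η (sortPerm η i) = η (sortPerm η j)) : sortPerm η i < sortPerm η j :=
  (Tuple.eq_sort_iff.mp (rfl : sortPerm η = Tuple.sort (OrderDual.toDual ∘ η))).2 i j hij
    (congrArg OrderDual.toDual h)

theorem inv_lt_of_antitone {η : Fin N → ℕ} {w : Equiv.Perm (Fin N)} (hw : Antitone (η ∘ w))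
    {p : Fin N × Fin N} (h1 : p.1 < p.2) (h2 : sortPerm η p.2 < sortPerm η p.1) :
    w⁻¹ (sortPerm η p.1) < w⁻¹ (sortPerm η p.2) := by
  have hle : η (sortPerm η p.2) ≤ η (sortPerm η p.1) := antitone_plus η h1.le
  have hne : η (sortPerm η p.1) ≠ η (sortPerm η p.2) := fun e =>
    absurd (sortPerm_lt_of_lt η h1 e) (not_lt.mpr h2.le)
  by_contra hcon
  have h3 := hw (not_lt.mp hcon)
  simp at h3
  omega

theorem image_subset_inversions {η : Fin N → ℕ} {w : Equiv.Perm (Fin N)}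
    (hw : Antitone (η ∘ w)) :
    (Finset.univ.filter fun p : Fin N × Fin N =>
        p.1 < p.2 ∧ sortPerm η p.2 < sortPerm η p.1).image
      (fun p => (w⁻¹ (sortPerm η p.1), w⁻¹ (sortPerm η p.2))) ⊆
    Finset.univ.filter fun p : Fin N × Fin N => p.1 < p.2 ∧ w p.2 < w p.1 := by
  intro q hq
  simp only [Finset.mem_image, Finset.mem_filter, Finset.mem_univ, true_and] at hq ⊢
  obtain ⟨p, ⟨h1, h2⟩, rfl⟩ := hq
  exact ⟨inv_lt_of_antitone hw h1 h2, by simpa using h2⟩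

theorem card_image_inversions (η : Fin N → ℕ) (w : Equiv.Perm (Fin N)) :
    ((Finset.univ.filter fun p : Fin N × Fin N =>
        p.1 < p.2 ∧ sortPerm η p.2 < sortPerm η p.1).image
      (fun p => (w⁻¹ (sortPerm η p.1), w⁻¹ (sortPerm η p.2)))).card = permLength (sortPerm η) := by
  refine Finset.card_image_of_injective _ ?_
  rintro ⟨a, b⟩ ⟨c, d⟩ h
  simpa using h

theorem permLength_sortPerm_le {η : Fin N → ℕ} {w : Equiv.Perm (Fin N)}
    (hw : Antitone (η ∘ w)) : permLength (sortPerm η) ≤ permLength w := by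
  rw [← card_image_inversions η w]
  exact Finset.card_le_card (image_subset_inversions hw)

theorem eq_sortPerm_of_permLength_le {η : Fin N → ℕ} {w : Equiv.Perm (Fin N)}
    (hw : Antitone (η ∘ w)) (hl : permLength w ≤ permLength (sortPerm η)) : w = sortPerm η := by
  have heq := Finset.eq_of_subset_of_card_le (image_subset_inversions hw)
    (by rw [card_image_inversions η w]; exact hl)
  refine Tuple.eq_sort_iff.mpr ⟨hw, fun i j hij h => ?_⟩
  have h' : η (w i) = η (w j) := congrArg OrderDual.ofDual h
  by_contra hcon
  have hlt : w j < w i := lt_of_le_of_ne (not_lt.mp hcon) fun e => hij.ne' (w.injective e)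
  have hmem : (i, j) ∈ Finset.univ.filter
      fun p : Fin N × Fin N => p.1 < p.2 ∧ w p.2 < w p.1 := by simp [hij, hlt]
  rw [← heq] at hmem
  simp only [Finset.mem_image, Finset.mem_filter, Finset.mem_univ, true_and] at hmem
  obtain ⟨p, ⟨h1, h2⟩, h3⟩ := hmem
  rw [Prod.mk.injEq] at h3
  have e1 : sortPerm η p.1 = w i := by rw [← h3.1]; simp
  have e2 : sortPerm η p.2 = w j := by rw [← h3.2]; simp
  have := sortPerm_lt_of_lt η h1 (by rw [e1, e2, h'])
  exact absurd this (not_lt.mpr h2.le)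

end Orders

/-! ### Non-symmetric Jack polynomials -/

section NonSymJack

variable {K : Type*} [Field K] {N : ℕ}

/-- The eigenvalue `η̂_i` of the Dunkl operator `𝒟_i`. -/
def etaHat (α : K) (η : Fin N → ℕ) (i : Fin N) : K :=
  α * (η i : K) -
    (((Finset.univ.filter fun j => j < i ∧ η i ≤ η j).card
      + (Finset.univ.filter fun j => i < j ∧ η i < η j).card : ℕ) : K)

/-- `E` is a polynomial of the form `z^η + ∑_{ν ≺ η} a_{η,ν} z^ν` and `𝒟_i E = η̂_i E` for all
`i`. -/
structure IsNonSymJack (α : K) (η : Fin N → ℕ) (E : MvPolynomial (Fin N) K) : Prop where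
  coeff_self : E.coeff (Finsupp.equivFunOnFinite.symm η) = 1
  compLT_of_coeff_ne_zero : ∀ ν : Fin N →₀ ℕ, ⇑ν ≠ η → E.coeff ν ≠ 0 → CompLT ⇑ν η
  dunkl_eq : ∀ i, dunkl α i E = etaHat α η i • E

open Classical in
/-- The non-symmetric Jack polynomial `E_η`: the polynomial with the property `IsNonSymJack α η`,
and zero if there is none. -/
def nonSymJack (α : K) (η : Fin N → ℕ) : MvPolynomial (Fin N) K :=
  if h : ∃ E, IsNonSymJack α η E then h.choose else 0

end NonSymJack

/-! ### Superspace -/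

/-- The span of the `2N` anticommuting variables; `Sum.inl i` indexes `φ_i`, and `Sum.inr i`
indexes `θ_i`. -/
abbrev FermionSpan (K : Type*) [Field K] (N : ℕ) := (Fin N ⊕ Fin N) →₀ K

/-- The Grassmann algebra generated by `φ_1, …, φ_N, θ_1, …, θ_N`. -/
abbrev Grassmann (K : Type*) [Field K] (N : ℕ) := ExteriorAlgebra K (FermionSpan K N)

/-- Superpolynomials in the variables `(z_i, φ_i, θ_i)`, `1 ≤ i ≤ N`. -/
abbrev SuperPoly (K : Type*) [Field K] (N : ℕ) := MvPolynomial (Fin N) K ⊗[K] Grassmann K N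

/-- Fermionic sectors `M = (m₁, m₂, m₃)` with `m₁ + m₂ + m₃ ≤ N`, where `m₁`, `m₂`, `m₃` are the
numbers of doublets `φ_i θ_i`, of unpaired `φ_i`, and of unpaired `θ_i`. -/
abbrev Sector (N : ℕ) :=
  {m : Fin (N + 1) × Fin (N + 1) × Fin (N + 1) // (m.1 : ℕ) + m.2.1 + m.2.2 ≤ N}

namespace Sector

variable {N : ℕ} (M : Sector N)

def m₁ : ℕ := M.1.1
def m₂ : ℕ := M.1.2.1
def m₃ : ℕ := M.1.2.2

/-- The partial sums `M_0 = 0`, `M_1`, `M_2`, `M_3`. -/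
def partialSum (k : Fin 4) : ℕ := ![0, M.m₁, M.m₁ + M.m₂, M.m₁ + M.m₂ + M.m₃] k

theorem partialSum_bounds : M.partialSum 1 ≤ M.partialSum 2 ∧
    M.partialSum 2 ≤ M.partialSum 3 ∧ M.partialSum 3 ≤ N :=
  ⟨Nat.le_add_right _ _, Nat.le_add_right _ _, M.2⟩

/-- The block (numbered `0, 1, 2, 3`) that contains the index `i`, where the blocks are
`]0, M₁]`, `]M₁, M₂]`, `]M₂, M₃]` and `]M₃, N]` (in the numbering `1, …, N`). -/
def block (i : Fin N) : Fin 4 :=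
  if (i : ℕ) < M.partialSum 1 then 0
  else if (i : ℕ) < M.partialSum 2 then 1
  else if (i : ℕ) < M.partialSum 3 then 2
  else 3

/-- The Young subgroup `S_{M₁} × S_{]M₁,M₂]} × S_{]M₂,M₃]} × S_{]M₃,N]}` of `S_N`. -/
def youngSubgroup : Subgroup (Equiv.Perm (Fin N)) where
  carrier := {ω | ∀ i, M.block (ω i) = M.block i}
  mul_mem' := fun {a b} ha hb i => by
    rw [Equiv.Perm.mul_apply, ha (b i), hb i]
  one_mem' := fun _ => rfl
  inv_mem' := fun {a} ha i => by
    have h := ha (a⁻¹ i)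
    rw [← Equiv.Perm.mul_apply, mul_inv_cancel, Equiv.Perm.one_apply] at h
    exact h.symm

/-- The reversal of the order of the indices inside each of the four blocks. -/
def blockRev (i : Fin N) : Fin N :=
  if h1 : (i : ℕ) < M.partialSum 1 then
    ⟨M.partialSum 1 - 1 - i, by have := M.partialSum_bounds; have := i.2; omega⟩
  else if h2 : (i : ℕ) < M.partialSum 2 then
    ⟨M.partialSum 1 + M.partialSum 2 - 1 - i, by have := M.partialSum_bounds; have := i.2; omega⟩
  else if h3 : (i : ℕ) < M.partialSum 3 then
    ⟨M.partialSum 2 + M.partialSum 3 - 1 - i, by have := M.partialSum_bounds; have := i.2; omega⟩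
  else
    ⟨M.partialSum 3 + N - 1 - i, by have := M.partialSum_bounds; have := i.2; omega⟩

end Sector

section Super

variable (K : Type*) [Field K] {N : ℕ}

def phi (i : Fin N) : Grassmann K N := ExteriorAlgebra.ι K (Finsupp.single (Sum.inl i) 1)

def theta (i : Fin N) : Grassmann K N := ExteriorAlgebra.ι K (Finsupp.single (Sum.inr i) 1)

/-- The left derivative `φ_i^† = ∂/∂φ_i`. -/
def phiDag (i : Fin N) : Module.End K (Grassmann K N) :=
  CliffordAlgebra.contractLeft (Finsupp.lapply (Sum.inl i))

/-- The left derivative `θ_i^† = ∂/∂θ_i`. -/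
def thetaDag (i : Fin N) : Module.End K (Grassmann K N) :=
  CliffordAlgebra.contractLeft (Finsupp.lapply (Sum.inr i))

/-- `[φ;θ]_M = ∏_{i ≤ M₁} φ_i θ_i ∏_{M₁ < j ≤ M₂} φ_j ∏_{M₂ < k ≤ M₃} θ_k`, the products being
taken in increasing order of the index. -/
def fermionMonomial (M : Sector N) : Grassmann K N :=
  ((List.finRange N).map fun i =>
    ![phi K i * theta K i, phi K i, theta K i, 1] (M.block i)).prod

/-- `([φ;θ]_M)^†`: the derivatives `φ_i^†`, `θ_i^†` composed in the reverse order. -/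
def fermionMonomialDag (M : Sector N) : Module.End K (Grassmann K N) :=
  ((List.finRange N).reverse.map fun i =>
    ![thetaDag K i * phiDag K i, phiDag K i, thetaDag K i, 1] (M.block i)).prod

/-- The projector of the Grassmann algebra onto the line spanned by the monomial `[φ;θ]_M`: it
multiplies by `[φ;θ]_M` the constant term of `([φ;θ]_M)^† x`, so that it kills every other monomial
in the anticommuting variables. -/
def fermionProj (M : Sector N) : Module.End K (Grassmann K N) :=
  (ExteriorAlgebra.algebraMapInv.toLinearMap ∘ₗ fermionMonomialDag K M).smulRight
    (fermionMonomial K M)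

/-- The projector `𝒫^M` on superpolynomials, onto the terms `[φ;θ]_M f(z)`. -/
def superProj (M : Sector N) : Module.End K (SuperPoly K N) :=
  LinearMap.lTensor (MvPolynomial (Fin N) K) (fermionProj K M)

/-- The operator `𝒦_ω` sending `(z_i, φ_i, θ_i)` to `(z_{ω i}, φ_{ω i}, θ_{ω i})` for all `i`. -/
def superPerm (ω : Equiv.Perm (Fin N)) : Module.End K (SuperPoly K N) :=
  TensorProduct.map (permZ ω)
    (ExteriorAlgebra.map (Finsupp.lmapDomain K K (Sum.map ω ω))).toLinearMap

end Super

/-! ### Superpartitions and Jack superpolynomials -/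

/-- A superpartition `Λ` of length at most `N`, written as
`(Λ_1,…,Λ_{M₁}; Λ_{M₁+1},…,Λ_{M₂}; Λ_{M₂+1},…,Λ_{M₃}; Λ_{M₃+1},…,Λ_N)`: the first and the last
block are weakly decreasing, and the two others are strictly decreasing. Zeros are parts in the
first three blocks, and padding in the last one. -/
structure Superpartition (N : ℕ) where
  sector : Sector N
  part : Fin N → ℕ
  part_le : ∀ i j, i < j → sector.block i = sector.block j → part j ≤ part i
  part_lt : ∀ i j, i < j → sector.block i = sector.block j →
    (sector.block i = 1 ∨ sector.block i = 2) → part j < part i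

namespace Superpartition

variable {N : ℕ} (Λ : Superpartition N)

/-- `Λ^R`: the composition obtained by writing each of the four blocks in increasing order. -/
def rev : Fin N → ℕ := fun i => Λ.part (Λ.sector.blockRev i)

/-- `Λ^{[k]} = (Λ + 1^{M_k})⁺`, where `M_0 = 0`. -/
def bracket (k : Fin 4) : Fin N → ℕ :=
  plus fun i => Λ.part i + if (i : ℕ) < Λ.sector.partialSum k then 1 else 0

/-- The multiplicity of the part `a` in the block `b`. -/
def mult (b : Fin 4) (a : ℕ) : ℕ :=
  (Finset.univ.filter fun i => Λ.sector.block i = b ∧ Λ.part i = a).card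

/-- The factor `f_Λ`; the part `0` is counted in the first block only. -/
def fFactor : ℕ :=
  (∏ a ∈ Finset.univ.image Λ.part, (Λ.mult 0 a).factorial) *
    ∏ a ∈ (Finset.univ.image Λ.part).erase 0, (Λ.mult 3 a).factorial

end Superpartition

section Jack

variable {K : Type*} [Field K] {N : ℕ}

/-- The Jack superpolynomial `P_Λ^{(α)}`. -/
def jackSuper (α : K) (Λ : Superpartition N) : SuperPoly K N :=
  ((-1 : K) ^ (Λ.sector.m₂.choose 2 + Λ.sector.m₃.choose 2) / (Λ.fFactor : K)) •
    ∑ ω : Equiv.Perm (Fin N),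
      superPerm K ω (nonSymJack α Λ.rev ⊗ₜ[K] fermionMonomial K Λ.sector)

/-- The operator `∏_{i ≤ m} (𝒟_i + α + u) ∏_{m < j ≤ N} (𝒟_j + u)` on polynomials in `z`, the
product being taken in increasing order of the index. -/
def dunklProd (m : ℕ) (u α : K) : Module.End K (MvPolynomial (Fin N) K) :=
  ((List.finRange N).map fun i : Fin N =>
    if (i : ℕ) < m then dunkl α i + (α + u) • 1 else dunkl α i + u • 1).prod

/-- The Sekiguchi operators `S^{[k]}(u, α)`, for `k = 0, 1, 2, 3`. -/
def sekiguchi (N : ℕ) (k : Fin 4) (u α : K) : Module.End K (SuperPoly K N) :=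
  if k = 0 then LinearMap.rTensor (Grassmann K N) (dunklProd 0 u α)
  else ∑ M : Sector N, (Nat.card M.youngSubgroup : K)⁻¹ • ∑ ω : Equiv.Perm (Fin N),
    superPerm K ω * superProj K M *
      LinearMap.rTensor (Grassmann K N) (dunklProd (M.partialSum k) u α)

/-- `ε_λ(u, α) = ∏_{i=1}^N (α λ_i + 1 - i + u)`. -/
def sekiguchiEigenvalue (lam : Fin N → ℕ) (u α : K) : K :=
  ∏ i : Fin N, (α * (lam i : K) - ((i : ℕ) : K) + u)

end Jack

end N2Jack

end

noncomputable section

namespace N2Jack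

/-! ### Lengths of permutations -/

section Orders

variable {N : ℕ}

/-! The polynomial `E` attached to `Λ.rev` is a joint eigenfunction of the commuting operators 𝒟_i,
and the product of the (𝒟_i + α + u) with i ≤ m and the (𝒟_j + u) with j > m commutes with every
permutation preserving {1,…,m} (`permZ_dunklProd`). When S^{[k]} acts on the symmetrization of
[φ;θ]_M E, the projectors keep only the sector M and the terms 𝒦_ω with ω in its Young subgroup.
Such ω preserve {1,…,M_k}, so the Dunkl product acts on these terms by its eigenvalue on E. Summing
over S_N again restores the symmetrization, once for each element of the Young subgroup, and the
prefactor cancels this multiplicity. For k = 0 the product commutes with all of S_N and acts term by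
term.

The eigenvalue is computed from η̂_i = αη_i - rank(i), the rank being that of i in the stable
decreasing sort of η. The same sort orders η + 1^m, so the product of the shifted eigenvalues is ε
of (η + 1^m)⁺ (`prod_etaHat_add`).

For existence, the 𝒟_i commute, are triangular for ≺ with diagonal entries η̂_i, and have joint
spectra that separate compositions when α is not a non-positive rational (`etaHat_injective`). A
product of factors (𝒟_i - ν̂_i)/(η̂_i - ν̂_i) then turns z^η into E_η. Commutativity is propagated
from the constants by means of the relations of the 𝒟_i with adjacent transpositions and with one
affine generator.

For nonvanishing, the coefficient of z^{Λ^R}[φ;θ]_M in the symmetrization counts the stabilizer of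
Λ^R in the Young subgroup. No other term contributes, because Λ^R is minimal among its
rearrangements inside the blocks. -/

theorem permLength_lt_swap_mul {w : Equiv.Perm (Fin N)} {i j : Fin N} (hij : i < j)
    (h : w⁻¹ i < w⁻¹ j) : permLength w < permLength (Equiv.swap i j * w) := by
  obtain ⟨P, rfl⟩ := w.surjective i
  obtain ⟨Q, rfl⟩ := w.surjective j
  simp at h
  have key : ∀ x, (Equiv.swap (w P) (w Q) * w) x = w (Equiv.swap P Q x) := fun x => by
    rw [Equiv.Perm.mul_apply, Equiv.swap_apply_apply]; simp
  have hmem : (P, Q) ∈ Finset.univ.filter fun p : Fin N × Fin N =>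
      p.1 < p.2 ∧ (Equiv.swap (w P) (w Q) * w) p.2 < (Equiv.swap (w P) (w Q) * w) p.1 := by
    simp only [Finset.mem_filter, Finset.mem_univ, true_and, key]
    simpa using ⟨h, hij⟩
  have hw : ∀ x y, w x = w y ↔ x = y := fun x y => w.injective.eq_iff
  refine lt_of_le_of_lt ?_ (Finset.card_erase_lt_of_mem hmem)
  -- Inversions of `w` inject into those of the product: positions are relabelled by the swap of `P`
  -- and `Q` when this keeps their order, and the pair is left alone otherwise. The inversion `(P,
  -- Q)` is missed.
  refine Finset.card_le_card_of_injOn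
    (fun p => if Equiv.swap P Q p.1 < Equiv.swap P Q p.2 then
      (Equiv.swap P Q p.1, Equiv.swap P Q p.2) else p) ?_ ?_
  · rintro ⟨p, q⟩ hp
    simp only [Finset.coe_filter, Finset.mem_univ, true_and, Set.mem_ofPred_eq] at hp
    simp only [Finset.coe_erase, Finset.coe_filter, Finset.mem_univ, true_and, key,
      Set.mem_sdiff, Set.mem_ofPred_eq, Set.mem_singleton_iff]
    by_cases hc : Equiv.swap P Q p < Equiv.swap P Q q
    · rw [if_pos hc]
      refine ⟨⟨hc, by simpa using hp.2⟩, fun e => ?_⟩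
      rw [Prod.mk.injEq, Equiv.swap_apply_eq_iff, Equiv.swap_apply_eq_iff] at e
      simp only [Equiv.swap_apply_left, Equiv.swap_apply_right] at e
      rw [e.1, e.2] at hp
      exact absurd hp.1 h.not_gt
    · rw [if_neg hc]
      simp only [Equiv.swap_apply_def] at hc ⊢
      refine ⟨⟨hp.1, ?_⟩, fun e => ?_⟩
      · have := hp.1
        have := hp.2
        split_ifs at hc ⊢ <;> subst_vars <;> order
      · rw [Prod.mk.injEq] at e
        rw [e.1, e.2] at hp
        exact absurd hp.2 hij.not_gt
  · rintro ⟨p, q⟩ hp ⟨p', q'⟩ hp' e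
    simp only [Finset.coe_filter, Finset.mem_univ, true_and, Set.mem_ofPred_eq] at hp hp' e
    have h1 := hp.1
    have h2 := hp'.1
    split_ifs at e with c1 c2 c2
    · simpa using e
    · rw [Prod.mk.injEq] at e
      rw [← e.1, ← e.2] at c2
      simp only [Equiv.swap_apply_self] at c2
      exact absurd h1 c2
    · rw [Prod.mk.injEq] at e
      rw [e.1, e.2] at c1
      simp only [Equiv.swap_apply_self] at c1
      exact absurd h2 c1
    · exact e

/-- Every permutation that preserves a monotone labelling is reached from the identity by
adjacent transpositions of indices with the same label. -/
theorem perm_induction_of_monotone_label {n : ℕ} (c : Fin (n + 1) → ℕ) (hc : Monotone c)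
    {p : Equiv.Perm (Fin (n + 1)) → Prop} (one : p 1)
    (swap_mul : ∀ (k : Fin n) (w), c k.castSucc = c k.succ → p w →
      p (Equiv.swap k.castSucc k.succ * w))
    (w : Equiv.Perm (Fin (n + 1))) (hw : ∀ i, c (w i) = c i) : p w := by
  induction hl : permLength w using Nat.strong_induction_on generalizing w with
  | _ l ih =>
    by_cases hm : ∀ k : Fin n, w⁻¹ k.castSucc < w⁻¹ k.succ
    · have hs : StrictMono ⇑(w⁻¹) := Fin.strictMono_iff_lt_succ.mpr hm
      have h1 : w⁻¹ = 1 := by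
        ext i
        have := congrArg (fun e : Fin (n + 1) ≃o Fin (n + 1) => e i)
          (Subsingleton.elim (StrictMono.orderIsoOfSurjective
            (w⁻¹ : Equiv.Perm (Fin (n + 1))) hs w⁻¹.surjective) (OrderIso.refl _))
        simpa using congrArg Fin.val this
      rw [inv_eq_one] at h1
      rw [h1]; exact one
    · push Not at hm
      obtain ⟨k, hk⟩ := hm
      have hlt : w⁻¹ k.succ < w⁻¹ k.castSucc :=
        lt_of_le_of_ne hk fun e => (Fin.castSucc_lt_succ (i := k)).ne' (w⁻¹.injective e)
      have hw' : ∀ i, c (w⁻¹ i) = c i := fun i => by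
        have := hw (w⁻¹ i)
        rw [← Equiv.Perm.mul_apply, mul_inv_cancel, Equiv.Perm.one_apply] at this
        exact this.symm
      -- `w⁻¹` preserves labels but reverses this adjacent pair, so monotonicity gives both
      -- inequalities.
      have hck : c k.castSucc = c k.succ := by
        refine le_antisymm (hc (Fin.castSucc_lt_succ (i := k)).le) ?_
        rw [← hw' k.castSucc, ← hw' k.succ]
        exact hc hlt.le
      set w' := Equiv.swap k.castSucc k.succ * w with hw'def
      have hww' : w = Equiv.swap k.castSucc k.succ * w' := by
        rw [hw'def, ← mul_assoc, Equiv.swap_mul_self, one_mul]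
      have hlen : permLength w' < l := by
        rw [← hl, hww']
        refine permLength_lt_swap_mul (Fin.castSucc_lt_succ (i := k)) ?_
        simpa [hw'def, mul_inv_rev, Equiv.Perm.mul_apply] using hlt
      rw [hww']
      refine swap_mul k w' hck (ih _ hlen w' (fun i => ?_) rfl)
      rw [← hw i, hw'def, Equiv.Perm.mul_apply, Equiv.swap_apply_def]
      split_ifs with h1 h2
      · rw [h1, hck]
      · rw [h2, hck]
      · rfl

/-- Stability of the sort means that it inverts exactly the pairs of positions where the larger
entry stands on the right. Lengths can thus be compared without sorting. -/
theorem permLength_sortPerm (η : Fin N → ℕ) :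
    permLength (sortPerm η) =
      (Finset.univ.filter fun p : Fin N × Fin N => p.1 < p.2 ∧ η p.1 < η p.2).card := by
  refine Finset.card_nbij' (fun p => (sortPerm η p.2, sortPerm η p.1))
    (fun p => ((sortPerm η)⁻¹ p.2, (sortPerm η)⁻¹ p.1)) ?_ ?_ ?_ ?_
  · rintro ⟨p, q⟩ h
    simp only [Finset.coe_filter, Finset.mem_univ, true_and, Set.mem_ofPred_eq] at h ⊢
    refine ⟨h.2, lt_of_le_of_ne (antitone_plus η h.1.le) fun e => ?_⟩
    exact absurd (sortPerm_lt_of_lt η h.1 e.symm) h.2.not_gt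
  · rintro ⟨p, q⟩ h
    simp only [Finset.coe_filter, Finset.mem_univ, true_and, Set.mem_ofPred_eq] at h ⊢
    refine ⟨?_, by simpa using h.1⟩
    by_contra hcon
    have := antitone_plus η (not_lt.mp hcon)
    simp [plus] at this
    omega
  · rintro ⟨p, q⟩ _
    simp
  · rintro ⟨p, q⟩ _
    simp

theorem plus_eq_of_antitone {η : Fin N → ℕ} {w : Equiv.Perm (Fin N)} (hw : Antitone (η ∘ w)) :
    η ∘ w = plus η := by
  have := Tuple.unique_monotone (f := OrderDual.toDual ∘ η) (σ := w) (τ := sortPerm η)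
    hw (antitone_plus η)
  exact this

theorem plus_comp_perm (η : Fin N → ℕ) (σ : Equiv.Perm (Fin N)) : plus (η ∘ σ) = plus η := by
  have h : Antitone (η ∘ (σ * sortPerm (η ∘ σ))) := antitone_plus (η ∘ σ)
  exact plus_eq_of_antitone h

/-! ### The order on compositions -/

theorem BruhatLT.permLength_lt {u v : Equiv.Perm (Fin N)} (h : BruhatLT u v) :
    permLength u < permLength v := by
  induction h with
  | single h => exact h.2
  | tail _ h ih => exact ih.trans h.2

theorem DomLE.trans {a b c : Fin N → ℕ} (h : DomLE a b) (h' : DomLE b c) : DomLE a c :=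
  ⟨h.1.trans h'.1, fun k => (h.2 k).trans (h'.2 k)⟩

theorem DomLE.antisymm {a b : Fin N → ℕ} (h : DomLE a b) (h' : DomLE b a) : a = b := by
  have hs : ∀ (g : Fin N → ℕ) (i : Fin N),
      ∑ x ∈ Finset.univ.filter (fun x : Fin N => (x : ℕ) < i + 1), g x =
        g i + ∑ x ∈ Finset.univ.filter (fun x : Fin N => (x : ℕ) < i), g x := by
    intro g i
    rw [← Finset.sum_insert (by simp)]
    refine Finset.sum_congr ?_ fun _ _ => rfl
    ext x
    simp only [Finset.mem_filter, Finset.mem_univ, true_and, Finset.mem_insert, Fin.ext_iff]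
    omega
  funext i
  have h1 := le_antisymm (h.2 i) (h'.2 i)
  have h2 := le_antisymm (h.2 (i + 1)) (h'.2 (i + 1))
  rw [hs, hs, h1] at h2
  omega

theorem CompLT.trans {a b c : Fin N → ℕ} (h : CompLT a b) (h' : CompLT b c) : CompLT a c := by
  rcases h with ⟨h1, h2⟩ | ⟨h1, h2⟩ <;> rcases h' with ⟨h3, h4⟩ | ⟨h3, h4⟩
  · refine Or.inl ⟨h1.trans h3, fun e => h2 ?_⟩
    rw [← e] at h3
    exact h1.antisymm h3
  · rw [h3] at h1 h2
    exact Or.inl ⟨h1, h2⟩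
  · rw [← h1] at h3 h4
    exact Or.inl ⟨h3, h4⟩
  · exact Or.inr ⟨h1.trans h3, Relation.TransGen.trans h4 h2⟩

theorem CompLT.irrefl (a : Fin N → ℕ) : ¬ CompLT a a := by
  rintro (⟨_, h⟩ | ⟨_, h⟩)
  · exact h rfl
  · exact absurd h.permLength_lt (lt_irrefl _)

theorem sum_plus (η : Fin N → ℕ) : ∑ i, plus η i = ∑ i, η i :=
  Equiv.sum_comp (sortPerm η) η

theorem CompLT.sum_eq {ν η : Fin N → ℕ} (h : CompLT ν η) : ∑ i, ν i = ∑ i, η i := by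
  rw [← sum_plus ν, ← sum_plus η]
  rcases h with ⟨h, _⟩ | ⟨h, _⟩
  · exact h.1
  · rw [h]

/-- After the common indices are discarded, two sets of equal size remain, and every index left in
`T` lies beyond every index left in the initial segment. The supremum of `g` on the former separates
the two sums. -/
theorem sum_le_sum_filter_of_antitone {g : Fin N → ℕ} (hg : Antitone g) (k : ℕ)
    (T : Finset (Fin N))
    (hT : T.card = (Finset.univ.filter (fun i : Fin N => (i : ℕ) < k)).card) :
    ∑ i ∈ T, g i ≤ ∑ i ∈ Finset.univ.filter (fun i : Fin N => (i : ℕ) < k), g i := by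
  set A := Finset.univ.filter (fun i : Fin N => (i : ℕ) < k) with hA
  rw [← Finset.sum_inter_add_sum_sdiff T A, ← Finset.sum_inter_add_sum_sdiff A T,
    Finset.inter_comm T A]
  refine Nat.add_le_add_left ?_ _
  calc ∑ i ∈ T \ A, g i ≤ (T \ A).card • (T \ A).sup g :=
        Finset.sum_le_card_nsmul _ _ _ fun x hx => Finset.le_sup hx
    _ = (A \ T).card • (T \ A).sup g := by rw [Finset.card_sdiff_comm hT]
    _ ≤ ∑ i ∈ A \ T, g i := by
        refine Finset.card_nsmul_le_sum _ _ _ fun x hx => Finset.sup_le fun y hy => hg ?_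
        simp only [hA, Finset.mem_sdiff, Finset.mem_filter, Finset.mem_univ, true_and] at hx hy
        rw [Fin.le_def]
        omega

/-- A partial sum of ν⁺ is a sum of ν over some set of positions, and a sum of η over a set of the
same size is at most the partial sum of η⁺. Dominance is thereby tested without sorting. -/
theorem domLE_plus_of_forall_exists {ν η : Fin N → ℕ} (hsum : ∑ i, ν i = ∑ i, η i)
    (h : ∀ S : Finset (Fin N), ∃ T : Finset (Fin N), T.card = S.card ∧
      ∑ i ∈ S, ν i ≤ ∑ i ∈ T, η i) : DomLE (plus ν) (plus η) := by
  refine ⟨by rw [sum_plus, sum_plus, hsum], fun k => ?_⟩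
  set A := Finset.univ.filter (fun i : Fin N => (i : ℕ) < k) with hA
  obtain ⟨T, hT, hle⟩ := h (A.map (sortPerm ν).toEmbedding)
  rw [Finset.card_map] at hT
  rw [Finset.sum_map] at hle
  refine hle.trans ?_
  have h2 := sum_le_sum_filter_of_antitone (antitone_plus η) k
    (T.map (sortPerm η)⁻¹.toEmbedding) (by rw [Finset.card_map, hT])
  rw [Finset.sum_map] at h2
  simpa [plus] using h2

/-- Moving two distinct entries of a composition strictly towards each other gives a smaller
composition. -/
theorem compLT_of_between {ν η : Fin N → ℕ} {i j : Fin N}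
    (hoff : ∀ k, k ≠ i → k ≠ j → ν k = η k) (hsum : ν i + ν j = η i + η j)
    (h1 : η j < ν i) (h2 : ν i < η i) : CompLT ν η := by
  have hij : i ≠ j := by
    rintro rfl
    omega
  have split : ∀ (S : Finset (Fin N)) (g : Fin N → ℕ), ∑ k ∈ S, g k =
      (if i ∈ S then g i else 0) + (if j ∈ S then g j else 0) +
        ∑ k ∈ (S.erase i).erase j, g k := by
    intro S g
    by_cases hi : i ∈ S <;> by_cases hj : j ∈ S
    · rw [if_pos hi, if_pos hj, ← Finset.add_sum_erase _ _ hi,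
        ← Finset.add_sum_erase _ _ (Finset.mem_erase.mpr ⟨hij.symm, hj⟩), add_assoc]
    · rw [if_pos hi, if_neg hj, ← Finset.add_sum_erase _ _ hi,
        Finset.erase_eq_of_notMem (s := S.erase i) (by simp [hj])]; rfl
    · rw [if_neg hi, if_pos hj, Finset.erase_eq_of_notMem hi, ← Finset.add_sum_erase _ _ hj]
      omega
    · rw [if_neg hi, if_neg hj, Finset.erase_eq_of_notMem hi, Finset.erase_eq_of_notMem hj]
      omega
  have rest : ∀ (S : Finset (Fin N)) (f : ℕ → ℕ), ∑ k ∈ (S.erase i).erase j, f (ν k) =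
      ∑ k ∈ (S.erase i).erase j, f (η k) := by
    intro S f
    refine Finset.sum_congr rfl fun k hk => ?_
    simp only [Finset.mem_erase] at hk
    rw [hoff k hk.2.1 hk.1]
  refine Or.inl ⟨domLE_plus_of_forall_exists ?_ fun S => ?_, fun e => ?_⟩
  · have h3 := split Finset.univ ν
    have h4 := split Finset.univ η
    have h5 := rest Finset.univ id
    simp only [Finset.mem_univ, if_true, id] at h3 h4 h5
    omega
  -- `T = S` works unless `S` contains `j` alone; there the entry at `j` has grown, but stays below
  -- `η i`, so `j` is traded for `i`.
  · by_cases hc : j ∈ S ∧ i ∉ S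
    · refine ⟨insert i (S.erase j), ?_, ?_⟩
      · rw [Finset.card_insert_of_notMem (by simp [hc.2]), Finset.card_erase_add_one hc.1]
      · have h5 := rest S id
        simp only [id] at h5
        rw [split S, if_neg hc.2, if_pos hc.1, h5,
          Finset.sum_insert (by simp [hc.2]), Finset.erase_eq_of_notMem hc.2]
        omega
    · refine ⟨S, rfl, ?_⟩
      have h5 := rest S id
      simp only [id] at h5
      rw [split S ν, split S η, h5]
      split_ifs with h6 h7 h8
      · omega
      · omega
      · exact absurd ⟨h8, h6⟩ hc
      · omega
  -- Strictness: the sum of squares is invariant under rearrangement and drops when two entries move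
  -- together.
  · have hsq : ∀ ρ : Fin N → ℕ, ∑ k, plus ρ k ^ 2 = ∑ k, ρ k ^ 2 := fun ρ =>
      Equiv.sum_comp (sortPerm ρ) fun k => ρ k ^ 2
    have h3 := split Finset.univ fun k => ν k ^ 2
    have h4 := split Finset.univ fun k => η k ^ 2
    have h5 := rest Finset.univ fun x => x ^ 2
    have h6 := hsq ν
    rw [e, hsq η, h3, h4] at h6
    simp only [Finset.mem_univ, if_true] at h5 h6
    rw [h5] at h6
    nlinarith

/-- With no entry between the two positions tied to either value, exchanging them does not disturb
the order of ties, so the stable sort just follows the transposition. -/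
theorem sortPerm_comp_swap {η : Fin N → ℕ} {i j : Fin N}
    (hbetween : ∀ k, i < k → k < j → η k ≠ η i ∧ η k ≠ η j) (hij : i < j) (h : η j < η i) :
    sortPerm (η ∘ Equiv.swap i j) = Equiv.swap i j * sortPerm η := by
  refine (Tuple.eq_sort_iff.mpr ⟨?_, fun p q hpq e => ?_⟩).symm
  · intro p q hpq
    have := antitone_plus η hpq
    simpa [plus, OrderDual.toDual_le_toDual] using this
  · have e' : η (sortPerm η p) = η (sortPerm η q) := by
      simpa using congrArg OrderDual.ofDual e
    have hlt := sortPerm_lt_of_lt η hpq e'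
    simp only [Equiv.Perm.mul_apply]
    generalize sortPerm η p = a at *
    generalize sortPerm η q = b at *
    simp only [Equiv.swap_apply_def]
    have hb1 := hbetween a
    have hb2 := hbetween b
    split_ifs <;> subst_vars <;> grind

/-- Without intermediate ties, a single length-increasing transposition relates the two sorting
permutations. If an intermediate entry equals `η i` or `η j`, two shorter exchanges through its
position give the same composition. -/
theorem compLT_comp_swap {η : Fin N → ℕ} {i j : Fin N} (hij : i < j) (h : η j < η i) :
    CompLT (η ∘ Equiv.swap i j) η := by
  induction hd : (j : ℕ) - i using Nat.strong_induction_on generalizing η i j with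
  | _ d ih =>
    by_cases hb : ∀ k, i < k → k < j → η k ≠ η i ∧ η k ≠ η j
    · refine Or.inr ⟨plus_comp_perm _ _, Relation.TransGen.single ⟨⟨i, j,
        sortPerm_comp_swap hb hij h⟩, ?_⟩⟩
      rw [sortPerm_comp_swap hb hij h]
      refine permLength_lt_swap_mul hij ?_
      by_contra hcon
      have := antitone_plus η (not_lt.mp hcon)
      simp [plus] at this
      omega
    · push Not at hb
      obtain ⟨k, hik, hkj, hk⟩ := hb
      have hd1 : (j : ℕ) - k < d := by rw [Fin.lt_def] at hik hkj; omega
      have hd2 : (k : ℕ) - i < d := by rw [Fin.lt_def] at hik hkj; omega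
      by_cases hki : η k = η i
      · have s1 := ih (η := η) _ hd1 hkj (by omega) rfl
        have s2 := ih (η := η ∘ Equiv.swap k j) _ hd2 hik
          (by simp [Equiv.swap_apply_of_ne_of_ne hik.ne hij.ne]; omega) rfl
        convert s2.trans s1 using 1
        funext x
        simp only [Function.comp_apply, Equiv.swap_apply_def]
        grind
      · have hk' := hk hki
        have s1 := ih (η := η) _ hd2 hik (by omega) rfl
        have s2 := ih (η := η ∘ Equiv.swap i k) _ hd1 hkj
          (by simp [Equiv.swap_apply_of_ne_of_ne hij.ne' hkj.ne']; omega) rfl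
        convert s2.trans s1 using 1
        funext x
        simp only [Function.comp_apply, Equiv.swap_apply_def]
        grind

end Orders

/-! ### The degenerate affine Hecke relations -/

section Hecke

variable {K : Type*} [Field K] {N : ℕ}

open MvPolynomial

theorem permZ_permZ (σ τ : Equiv.Perm (Fin N)) (f : MvPolynomial (Fin N) K) :
    permZ σ (permZ τ f) = permZ (σ * τ) f := by
  simp only [permZ, AlgHom.toLinearMap_apply, rename_rename]
  rfl

@[simp]
theorem permZ_one (f : MvPolynomial (Fin N) K) : permZ 1 f = f := by
  simp [permZ]

theorem permZ_mul_apply (σ : Equiv.Perm (Fin N)) (f g : MvPolynomial (Fin N) K) :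
    permZ σ (f * g) = permZ σ f * permZ σ g := by
  simp [permZ]

@[simp]
theorem permZ_X (σ : Equiv.Perm (Fin N)) (i : Fin N) :
    permZ σ (X i : MvPolynomial (Fin N) K) = X (σ i) := by
  simp [permZ]

@[simp]
theorem permZ_C (σ : Equiv.Perm (Fin N)) (a : K) :
    permZ σ (C a : MvPolynomial (Fin N) K) = C a := by
  simp [permZ]

@[simp]
theorem permZ_swap_self (i j : Fin N) (f : MvPolynomial (Fin N) K) :
    permZ (Equiv.swap i j) (permZ (Equiv.swap i j) f) = f := by
  rw [permZ_permZ, Equiv.swap_mul_self, permZ_one]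

theorem permZ_pderiv (σ : Equiv.Perm (Fin N)) (i : Fin N) (f : MvPolynomial (Fin N) K) :
    permZ σ (pderiv i f) = pderiv (σ i) (permZ σ f) := by
  simp only [permZ, AlgHom.toLinearMap_apply]
  exact (pderiv_rename σ.injective i f).symm

theorem divDiff_self (i : Fin N) (f : MvPolynomial (Fin N) K) : divDiff i i f = 0 := by
  simp [divDiff]

theorem permZ_divDiff (σ : Equiv.Perm (Fin N)) (i j : Fin N) (f : MvPolynomial (Fin N) K) :
    permZ σ (divDiff i j f) = divDiff (σ i) (σ j) (permZ σ f) := by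
  rcases eq_or_ne i j with rfl | h
  · rw [divDiff_self, divDiff_self, map_zero]
  · have h' : σ i ≠ σ j := fun e => h (σ.injective e)
    apply mul_left_cancel₀ (X_sub_X_ne_zero (K := K) h')
    rw [X_sub_X_mul_divDiff h', ← permZ_X σ i, ← permZ_X σ j, ← map_sub, ← permZ_mul_apply,
      X_sub_X_mul_divDiff h, map_sub, permZ_permZ, permZ_permZ, Equiv.mul_swap_eq_swap_mul]

theorem divDiff_symm (i j : Fin N) (f : MvPolynomial (Fin N) K) :
    divDiff i j f = -divDiff j i f := by
  rcases eq_or_ne i j with rfl | h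
  · rw [divDiff_self, neg_zero]
  · apply mul_left_cancel₀ (X_sub_X_ne_zero (K := K) h)
    have h1 := X_sub_X_mul_divDiff h f
    have h2 := X_sub_X_mul_divDiff h.symm f
    rw [Equiv.swap_comm] at h2
    linear_combination h1 - h2

/-- Twisted Leibniz rule for the divided difference; the extra term is the source of every
correction in the affine relations below. -/
theorem divDiff_X_left_mul {i j : Fin N} (h : i ≠ j) (f : MvPolynomial (Fin N) K) :
    divDiff i j (X i * f) = X j * divDiff i j f + f := by
  apply mul_left_cancel₀ (X_sub_X_ne_zero (K := K) h)
  rw [X_sub_X_mul_divDiff h, permZ_mul_apply, permZ_X, Equiv.swap_apply_left]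
  linear_combination -(X j) * X_sub_X_mul_divDiff h f

theorem divDiff_X_right_mul {i j : Fin N} (h : i ≠ j) (f : MvPolynomial (Fin N) K) :
    divDiff i j (X j * f) = X i * divDiff i j f - f := by
  apply mul_left_cancel₀ (X_sub_X_ne_zero (K := K) h)
  rw [X_sub_X_mul_divDiff h, permZ_mul_apply, permZ_X, Equiv.swap_apply_right]
  linear_combination -(X i) * X_sub_X_mul_divDiff h f

theorem divDiff_X_mul {i j k : Fin N} (hi : k ≠ i) (hj : k ≠ j) (f : MvPolynomial (Fin N) K) :
    divDiff i j (X k * f) = X k * divDiff i j f := by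
  rcases eq_or_ne i j with rfl | h
  · rw [divDiff_self, divDiff_self, mul_zero]
  · apply mul_left_cancel₀ (X_sub_X_ne_zero (K := K) h)
    rw [X_sub_X_mul_divDiff h, permZ_mul_apply, permZ_X, Equiv.swap_apply_of_ne_of_ne hi hj]
    linear_combination -(X k) * X_sub_X_mul_divDiff h f

/-- The exchange term of `𝒟_i` that involves `K_{ij}`. -/
def exchTerm (i j : Fin N) (f : MvPolynomial (Fin N) K) : MvPolynomial (Fin N) K :=
  if j < i then X i * divDiff i j f else if i < j then X j * divDiff i j f else 0

theorem dunkl_apply (α : K) (i : Fin N) (f : MvPolynomial (Fin N) K) :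
    dunkl α i f = α • (X i * pderiv i f) + ∑ j, exchTerm i j f - ((i : ℕ) : K) • f := by
  have : ∑ j, exchTerm i j f = ∑ j ∈ Finset.univ.filter (fun j => j < i), X i * divDiff i j f +
      ∑ j ∈ Finset.univ.filter (fun j => i < j), X j * divDiff i j f := by
    rw [Finset.sum_filter, Finset.sum_filter, ← Finset.sum_add_distrib]
    refine Finset.sum_congr rfl fun j _ => ?_
    unfold exchTerm
    split_ifs with h1 h2
    · exact absurd h1 h2.not_gt
    · rw [add_zero]
    · rw [zero_add]
    · rw [add_zero]
  rw [this]
  simp [dunkl, mulZ, LinearMap.sum_apply, add_assoc]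

/-- An adjacent transposition fixing `i` never moves an index across `i`, so it merely permutes the
exchange terms of 𝒟_i. -/
theorem permZ_swap_dunkl_of_ne (α : K) {n : ℕ} (k : Fin n) {i : Fin (n + 1)}
    (h1 : i ≠ k.castSucc) (h2 : i ≠ k.succ) (f : MvPolynomial (Fin (n + 1)) K) :
    permZ (Equiv.swap k.castSucc k.succ) (dunkl α i f) =
      dunkl α i (permZ (Equiv.swap k.castSucc k.succ) f) := by
  set s := Equiv.swap k.castSucc k.succ with hs
  have hsi : s i = i := Equiv.swap_apply_of_ne_of_ne h1 h2
  have hlt : ∀ j, (s j < i ↔ j < i) ∧ (i < s j ↔ i < j) := by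
    intro j
    simp only [hs, Equiv.swap_apply_def]
    split_ifs with e1 e2
    · subst e1
      simp only [Fin.lt_def, Fin.ext_iff, ne_eq, Fin.val_succ, Fin.val_castSucc] at *
      omega
    · subst e2
      simp only [Fin.lt_def, Fin.ext_iff, ne_eq, Fin.val_succ, Fin.val_castSucc] at *
      omega
    · simp
  have hterm : ∀ j, permZ s (exchTerm i j f) = exchTerm i (s j) (permZ s f) := by
    intro j
    unfold exchTerm
    simp only [(hlt j).1, (hlt j).2]
    split_ifs <;> simp [permZ_mul_apply, permZ_divDiff, hsi]
  rw [dunkl_apply, dunkl_apply, map_sub, map_add, map_smul, map_smul, map_sum, permZ_mul_apply,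
    permZ_pderiv, permZ_X, hsi, Finset.sum_congr rfl fun j _ => hterm j,
    Equiv.sum_comp s fun j => exchTerm i j (permZ s f)]

/-- With s the transposition, only the exchange term of the pair itself changes side, which costs s
f - f. The constants of the two operators differ by one and give back s f, leaving f. -/
theorem permZ_swap_dunkl_castSucc (α : K) {n : ℕ} (k : Fin n)
    (f : MvPolynomial (Fin (n + 1)) K) :
    permZ (Equiv.swap k.castSucc k.succ) (dunkl α k.castSucc f) =
      dunkl α k.succ (permZ (Equiv.swap k.castSucc k.succ) f) + f := by
  set s := Equiv.swap k.castSucc k.succ with hs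
  set a := k.castSucc with ha
  set b := k.succ with hb
  have hab : a < b := Fin.castSucc_lt_succ
  have hsa : s a = b := Equiv.swap_apply_left _ _
  have hsb : s b = a := Equiv.swap_apply_right _ _
  have hterm : ∀ j, permZ s (exchTerm a j f) =
      exchTerm b (s j) (permZ s f) - if j = b then permZ s f - f else 0 := by
    intro j
    rcases eq_or_ne j b with rfl | hjb
    · have h := X_sub_X_mul_divDiff hab.ne' (permZ s f)
      rw [Equiv.swap_comm, permZ_swap_self] at h
      unfold exchTerm
      rw [if_neg hab.not_gt, if_pos hab, hsb, if_pos hab, if_pos rfl, permZ_mul_apply, permZ_X,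
        permZ_divDiff, hsa, hsb]
      linear_combination -h
    · rw [if_neg hjb, sub_zero]
      rcases eq_or_ne j a with rfl | hja
      · simp [exchTerm, hsa]
      · have hsj : s j = j := Equiv.swap_apply_of_ne_of_ne hja hjb
        have h1 : j < b ↔ j < a := by
          simp only [Fin.lt_def, Fin.ext_iff, ne_eq, ha, hb, Fin.val_succ, Fin.val_castSucc] at *
          omega
        have h2 : b < j ↔ a < j := by
          simp only [Fin.lt_def, Fin.ext_iff, ne_eq, ha, hb, Fin.val_succ, Fin.val_castSucc] at *
          omega
        unfold exchTerm
        rw [hsj]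
        simp only [h1, h2]
        split_ifs <;> simp [permZ_mul_apply, permZ_divDiff, hsa, hsj]
  rw [dunkl_apply, dunkl_apply, map_sub, map_add, map_smul, map_smul, map_sum, permZ_mul_apply,
    permZ_pderiv, permZ_X, hsa, Finset.sum_congr rfl fun j _ => hterm j, Finset.sum_sub_distrib,
    Equiv.sum_comp s fun j => exchTerm b j (permZ s f), Finset.sum_ite_eq']
  simp only [Finset.mem_univ, if_true, ha, hb, Fin.val_succ, Fin.val_castSucc, Nat.cast_add,
    Nat.cast_one, add_smul, one_smul]
  abel

theorem permZ_swap_dunkl_succ (α : K) {n : ℕ} (k : Fin n) (f : MvPolynomial (Fin (n + 1)) K) :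
    permZ (Equiv.swap k.castSucc k.succ) (dunkl α k.succ f) =
      dunkl α k.castSucc (permZ (Equiv.swap k.castSucc k.succ) f) - f := by
  have h := permZ_swap_dunkl_castSucc α k (permZ (Equiv.swap k.castSucc k.succ) f)
  rw [permZ_swap_self] at h
  rw [← permZ_swap_self k.castSucc k.succ (dunkl α k.castSucc _), h, map_add, permZ_swap_self]
  abel

/-- The affine generator `f ↦ z_N f(z_N, z_1, …, z_{N-1})`. -/
def affineShift {n : ℕ} (f : MvPolynomial (Fin (n + 1)) K) : MvPolynomial (Fin (n + 1)) K :=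
  X (Fin.last n) * permZ (finRotate (n + 1))⁻¹ f

/-- The rotation lowers the indices by one and sends the first to the last place. Only the exchange
with that index changes side, and its Leibniz correction accounts for the difference of the
constants. -/
theorem dunkl_affineShift_castSucc (α : K) {n : ℕ} (k : Fin n)
    (f : MvPolynomial (Fin (n + 1)) K) :
    dunkl α k.castSucc (affineShift f) = affineShift (dunkl α k.succ f) := by
  set c := (finRotate (n + 1))⁻¹ with hc
  have hcs : ∀ j : Fin n, c j.succ = j.castSucc := fun j => by
    rw [hc, Equiv.Perm.inv_eq_iff_eq, finRotate_apply, Fin.coeSucc_eq_succ]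
  have hc0 : c 0 = Fin.last n := by
    rw [hc, Equiv.Perm.inv_eq_iff_eq, finRotate_last]
  have hkl : k.castSucc ≠ Fin.last n := (Fin.castSucc_lt_last k).ne
  unfold affineShift
  rw [← hc]
  have hterm : ∀ j : Fin n, exchTerm k.castSucc j.castSucc (X (Fin.last n) * permZ c f) =
      X (Fin.last n) * permZ c (exchTerm k.succ j.succ f) := by
    intro j
    unfold exchTerm
    have hjl : j.castSucc ≠ Fin.last n := (Fin.castSucc_lt_last j).ne
    simp only [Fin.succ_lt_succ_iff, Fin.castSucc_lt_castSucc_iff]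
    split_ifs <;> simp [permZ_mul_apply, permZ_divDiff, hcs,
      divDiff_X_mul hkl.symm hjl.symm] <;> ring
  have hlast : exchTerm k.castSucc (Fin.last n) (X (Fin.last n) * permZ c f) =
      X (Fin.last n) * permZ c (exchTerm k.succ 0 f) - X (Fin.last n) * permZ c f := by
    unfold exchTerm
    rw [if_neg (Fin.castSucc_lt_last k).not_gt, if_pos (Fin.castSucc_lt_last k),
      if_pos (Fin.succ_pos k), divDiff_X_right_mul hkl, permZ_mul_apply, permZ_divDiff, permZ_X,
      hcs, hc0]
    ring
  rw [dunkl_apply, dunkl_apply, Fin.sum_univ_castSucc, Fin.sum_univ_succ (f := fun j => exchTerm _ j f),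
    Finset.sum_congr rfl fun j _ => hterm j, hlast, map_sub, map_add, map_smul, map_smul, map_add,
    map_sum, permZ_mul_apply, permZ_pderiv, permZ_X, hcs, Derivation.leibniz,
    pderiv_X_of_ne hkl.symm, ← Finset.mul_sum]
  simp only [Fin.val_succ, Fin.val_castSucc, Nat.cast_add, Nat.cast_one, smul_eq_C_mul,
    smul_eq_mul, C_add, C_1]
  ring

/-- Each of the `n` exchange terms yields one copy of the shifted polynomial, and these cancel the
constant of the last operator. The term in α comes from the derivative of the new factor z_N. -/
theorem dunkl_affineShift_last (α : K) {n : ℕ} (f : MvPolynomial (Fin (n + 1)) K) :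
    dunkl α (Fin.last n) (affineShift f) = affineShift (dunkl α 0 f + α • f) := by
  set c := (finRotate (n + 1))⁻¹ with hc
  have hcs : ∀ j : Fin n, c j.succ = j.castSucc := fun j => by
    rw [hc, Equiv.Perm.inv_eq_iff_eq, finRotate_apply, Fin.coeSucc_eq_succ]
  have hc0 : c 0 = Fin.last n := by
    rw [hc, Equiv.Perm.inv_eq_iff_eq, finRotate_last]
  unfold affineShift
  rw [← hc]
  have hterm : ∀ j : Fin n, exchTerm (Fin.last n) j.castSucc (X (Fin.last n) * permZ c f) =
      X (Fin.last n) * permZ c (exchTerm 0 j.succ f) + X (Fin.last n) * permZ c f := by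
    intro j
    unfold exchTerm
    rw [if_pos (Fin.castSucc_lt_last j), if_neg (Fin.succ_pos j).not_gt, if_pos (Fin.succ_pos j),
      divDiff_X_left_mul (Fin.castSucc_lt_last j).ne', permZ_mul_apply, permZ_divDiff, permZ_X,
      hcs, hc0]
    ring
  have hzero : ∀ (i : Fin (n + 1)) (g : MvPolynomial (Fin (n + 1)) K), exchTerm i i g = 0 :=
    fun i g => by simp [exchTerm]
  rw [dunkl_apply, dunkl_apply, Fin.sum_univ_castSucc, Fin.sum_univ_succ (f := fun j => exchTerm _ j f),
    Finset.sum_congr rfl fun j _ => hterm j, hzero, hzero, map_add, map_sub, map_add, map_smul,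
    map_smul, map_smul, map_add,
    map_sum, permZ_mul_apply, permZ_pderiv, permZ_X, hc0, Derivation.leibniz,
    pderiv_X_self, Finset.sum_add_distrib, ← Finset.mul_sum]
  simp only [Fin.val_last, Fin.val_zero, Nat.cast_zero, smul_eq_C_mul, Finset.sum_const,
    Finset.card_univ, Fintype.card_fin, nsmul_eq_mul, map_zero,
    smul_eq_mul, map_natCast]
  ring

theorem dunkl_affineShift (α : K) {n : ℕ} (i : Fin (n + 1)) (f : MvPolynomial (Fin (n + 1)) K) :
    dunkl α i (affineShift f) =
      affineShift (dunkl α (finRotate (n + 1) i) f + (if i = Fin.last n then α else 0) • f) := by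
  induction i using Fin.lastCases with
  | last => rw [dunkl_affineShift_last, finRotate_last, if_pos rfl]
  | cast k =>
    rw [dunkl_affineShift_castSucc, finRotate_apply, Fin.coeSucc_eq_succ,
      if_neg (Fin.castSucc_lt_last k).ne, zero_smul, add_zero]

theorem affineShift_permZ_finRotate {n : ℕ} (f : MvPolynomial (Fin (n + 1)) K) :
    affineShift (permZ (finRotate (n + 1)) f) = X (Fin.last n) * f := by
  rw [affineShift, permZ_permZ, inv_mul_cancel, permZ_one]

/-- A property of polynomials that holds for the constants, is closed under sums, adjacent
transpositions and the affine generator holds for all polynomials. -/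
theorem induction_affineShift {n : ℕ} {p : MvPolynomial (Fin (n + 1)) K → Prop}
    (const : ∀ a, p (C a)) (add : ∀ f g, p f → p g → p (f + g))
    (swap : ∀ (k : Fin n) f, p f → p (permZ (Equiv.swap k.castSucc k.succ) f))
    (shift : ∀ f, p f → p (affineShift f)) (f : MvPolynomial (Fin (n + 1)) K) : p f := by
  have perm : ∀ (w : Equiv.Perm (Fin (n + 1))) f, p f → p (permZ w f) := by
    intro w f hf
    refine perm_induction_of_monotone_label (fun _ => 0) monotone_const
      (p := fun w => p (permZ w f)) (by simpa using hf) (fun k w _ hw => ?_) w fun _ => rfl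
    rw [← permZ_permZ]
    exact swap k _ hw
  have last : ∀ f, p f → p (X (Fin.last n) * f) := fun f hf => by
    rw [← affineShift_permZ_finRotate]
    exact shift _ (perm _ _ hf)
  induction f using MvPolynomial.induction_on with
  | C a => exact const a
  | add f g hf hg => exact add f g hf hg
  | mul_X f i hf =>
    -- Multiplication by z_i is multiplication by z_N conjugated by a transposition.
    have h := perm (Equiv.swap i (Fin.last n)) _ (last _ (perm (Equiv.swap i (Fin.last n)) f hf))
    rwa [permZ_mul_apply, permZ_swap_self, permZ_X, Equiv.swap_apply_right, mul_comm] at h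

/-! ### Commutativity of the Dunkl operators -/

theorem dunkl_C (α : K) (i : Fin N) (a : K) : dunkl α i (C a) = C (-((i : ℕ) : K) * a) := by
  have h : ∀ i j : Fin N, divDiff i j (C a : MvPolynomial (Fin N) K) = 0 := by
    intro i j
    rcases eq_or_ne i j with rfl | h
    · exact divDiff_self _ _
    · apply mul_left_cancel₀ (X_sub_X_ne_zero (K := K) h)
      rw [X_sub_X_mul_divDiff h, permZ_C, sub_self, mul_zero]
  rw [dunkl_apply, Finset.sum_eq_zero fun j _ => by simp [exchTerm, h]]
  simp [smul_eq_C_mul]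

/-- Both operators are moved past the transposition. The lower-order corrections cancel or agree in
the two orders, which leaves the commutation on `f`. -/
theorem dunkl_comm_apply_permZ_swap (α : K) {n : ℕ} (k : Fin n)
    {f : MvPolynomial (Fin (n + 1)) K}
    (hf : ∀ i j, dunkl α i (dunkl α j f) = dunkl α j (dunkl α i f)) (i j : Fin (n + 1)) :
    dunkl α i (dunkl α j (permZ (Equiv.swap k.castSucc k.succ) f)) =
      dunkl α j (dunkl α i (permZ (Equiv.swap k.castSucc k.succ) f)) := by
  set s := permZ (K := K) (Equiv.swap k.castSucc k.succ) with hs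
  have ha : ∀ g, dunkl α k.castSucc (s g) = s (dunkl α k.succ g) + g := fun g => by
    rw [hs, permZ_swap_dunkl_succ, sub_add_cancel]
  have hb : ∀ g, dunkl α k.succ (s g) = s (dunkl α k.castSucc g) - g := fun g => by
    rw [hs, permZ_swap_dunkl_castSucc, add_sub_cancel_right]
  have hc : ∀ i, i = k.castSucc ∨ i = k.succ ∨ ∀ g, dunkl α i (s g) = s (dunkl α i g) := by
    intro i
    by_cases h1 : i = k.castSucc
    · exact Or.inl h1
    by_cases h2 : i = k.succ
    · exact Or.inr (Or.inl h2)
    · exact Or.inr (Or.inr fun g => (permZ_swap_dunkl_of_ne α k h1 h2 g).symm)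
  rcases hc i with rfl | rfl | hi <;> rcases hc j with rfl | rfl | hj
  · rfl
  · rw [ha, hb, map_sub, map_add, ha, hb, hf]
    abel
  · rw [ha, hj, map_add, hj, ha, hf]
  · rw [ha, hb, map_sub, map_add, ha, hb, hf]
    abel
  · rfl
  · rw [hb, hj, map_sub, hj, hb, hf]
  · rw [ha, hi, map_add, hi, ha, hf]
  · rw [hb, hi, map_sub, hi, hb, hf]
  · rw [hi, hj, hi, hj, hf]

/-- The Dunkl operators commute. -/
theorem dunkl_comm (α : K) (i j : Fin N) (f : MvPolynomial (Fin N) K) :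
    dunkl α i (dunkl α j f) = dunkl α j (dunkl α i f) := by
  cases N with
  | zero => exact i.elim0
  | succ n =>
    revert i j
    refine induction_affineShift (p := fun f => ∀ i j, dunkl α i (dunkl α j f) =
      dunkl α j (dunkl α i f)) ?_ ?_ ?_ ?_ f
    · intro a i j
      simp only [dunkl_C]
      congr 1
      ring
    · intro f g hf hg i j
      simp only [map_add, hf i j, hg i j]
    · intro k f hf i j
      exact dunkl_comm_apply_permZ_swap α k hf i j
    · intro f hf i j
      have key : ∀ i j : Fin (n + 1), dunkl α i (dunkl α j (affineShift f)) =
          affineShift (dunkl α (finRotate _ i) (dunkl α (finRotate _ j) f)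
            + (if j = Fin.last n then α else 0) • dunkl α (finRotate _ i) f
            + (if i = Fin.last n then α else 0) • (dunkl α (finRotate _ j) f
              + (if j = Fin.last n then α else 0) • f)) := fun i j => by
        rw [dunkl_affineShift, dunkl_affineShift, map_add, map_smul]
      rw [key, key, hf (finRotate _ i) (finRotate _ j), smul_add, smul_add,
        smul_comm (if i = Fin.last n then α else 0)]
      exact congrArg affineShift (by abel)

end Hecke

/-! ### Triangularity of the Dunkl operators -/

section Triangular

variable {K : Type*} [Field K] {N : ℕ}

open MvPolynomial

variable (K) in
/-- The span of the monomials `z^ν` with `ν ≺ η`. -/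
def lowerSpan (η : Fin N → ℕ) : Submodule K (MvPolynomial (Fin N) K) :=
  restrictSupport K {ν | CompLT ⇑ν η}

theorem mem_lowerSpan {η : Fin N → ℕ} {f : MvPolynomial (Fin N) K} :
    f ∈ lowerSpan K η ↔ ∀ ν : Fin N →₀ ℕ, f.coeff ν ≠ 0 → CompLT ⇑ν η := by
  rw [lowerSpan, mem_restrictSupport_iff]
  exact forall_congr' fun ν => imp_congr_left (by simp)

theorem monomial_mem_lowerSpan {η : Fin N → ℕ} {ν : Fin N →₀ ℕ} (h : CompLT ⇑ν η) :
    monomial ν (1 : K) ∈ lowerSpan K η :=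
  (monomial_mem_restrictSupport K).mpr (Or.inl h)

theorem lowerSpan_mono {ν η : Fin N → ℕ} (h : CompLT ν η) : lowerSpan K ν ≤ lowerSpan K η :=
  restrictSupport_mono K fun _ hμ => CompLT.trans hμ h

theorem lowerSpan_induction {η : Fin N → ℕ} (S : Submodule K (MvPolynomial (Fin N) K))
    (h : ∀ ν : Fin N →₀ ℕ, CompLT ⇑ν η → monomial ν (1 : K) ∈ S) : lowerSpan K η ≤ S := by
  rw [lowerSpan, restrictSupport_eq_span, Submodule.span_le]
  rintro _ ⟨ν, hν, rfl⟩
  exact h ν hν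

/-! ### Action on monomials -/

theorem permZ_monomial (σ : Equiv.Perm (Fin N)) (η : Fin N →₀ ℕ) :
    permZ σ (monomial η (1 : K)) = monomial (η.mapDomain σ) 1 := by
  simp [permZ, rename_monomial]

/-- The exponent obtained from `η` by putting `η_b + k` at `a` and `η_a - k` at `b`. -/
def exchange (η : Fin N →₀ ℕ) (a b : Fin N) (k : ℕ) : Fin N →₀ ℕ :=
  (η.update a (η b + k)).update b (η a - k)

theorem exchange_apply (η : Fin N →₀ ℕ) (a b : Fin N) (k : ℕ) (x : Fin N) :
    exchange η a b k x = if x = b then η a - k else if x = a then η b + k else η x := by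
  simp only [exchange, Finsupp.coe_update, Function.update_apply]

theorem exchange_sub {η : Fin N →₀ ℕ} {a b : Fin N} (h : η b ≤ η a) :
    exchange η a b (η a - η b) = η := by
  ext x
  rw [exchange_apply]
  split_ifs with h1 h2
  · subst h1; omega
  · subst h2; omega
  · rfl

theorem exchange_zero_apply (η : Fin N →₀ ℕ) (a b : Fin N) (x : Fin N) :
    exchange η a b 0 x = η (Equiv.swap a b x) := by
  rw [exchange_apply, Equiv.swap_apply_def]
  split_ifs <;> simp_all

/-- Consecutive exchanges differ by replacing one factor z_b by z_a; `μ` is what they have in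
common. -/
theorem exists_exponent_exchange {η : Fin N →₀ ℕ} {a b : Fin N} (hab : a ≠ b) {k : ℕ}
    (hk : k < η a - η b) : ∃ μ : Fin N →₀ ℕ,
      (X a * monomial μ 1 : MvPolynomial (Fin N) K) = monomial (exchange η a b (k + 1)) 1 ∧
      (X b * monomial μ 1 : MvPolynomial (Fin N) K) = monomial (exchange η a b k) 1 := by
  refine ⟨(η.update a (η b + k)).update b (η a - 1 - k), ?_, ?_⟩
  · rw [X, monomial_mul, one_mul]
    refine congrArg (fun d => monomial d (1 : K)) (Finsupp.ext fun x => ?_)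
    simp only [Finsupp.add_apply, Finsupp.single_apply, exchange_apply, Finsupp.coe_update,
      Function.update_apply]
    grind
  · rw [X, monomial_mul, one_mul]
    refine congrArg (fun d => monomial d (1 : K)) (Finsupp.ext fun x => ?_)
    simp only [Finsupp.add_apply, Finsupp.single_apply, exchange_apply, Finsupp.coe_update,
      Function.update_apply]
    grind

/-- A telescoping geometric sum, running from the swapped monomial at `k = 0` to z^η at `k = η a - η
b`. Multiplication by z_a retains the endpoint z^η, multiplication by z_b the swapped one. -/
theorem X_mul_divDiff_monomial {η : Fin N →₀ ℕ} {a b : Fin N} (hab : a ≠ b) (h : η b ≤ η a) :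
    X a * divDiff a b (monomial η (1 : K)) =
        ∑ k ∈ Finset.range (η a - η b), monomial (exchange η a b (k + 1)) 1 ∧
      X b * divDiff a b (monomial η (1 : K)) =
        ∑ k ∈ Finset.range (η a - η b), monomial (exchange η a b k) 1 := by
  have hex : ∀ k, ∃ μ : Fin N →₀ ℕ, k < η a - η b →
      (X a * monomial μ 1 : MvPolynomial (Fin N) K) = monomial (exchange η a b (k + 1)) 1 ∧
      (X b * monomial μ 1 : MvPolynomial (Fin N) K) = monomial (exchange η a b k) 1 := by
    intro k
    by_cases hk : k < η a - η b
    · obtain ⟨μ, hμ⟩ := exists_exponent_exchange (K := K) hab hk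
      exact ⟨μ, fun _ => hμ⟩
    · exact ⟨0, fun h => absurd h hk⟩
  choose μ hμ using hex
  have ha : X a * ∑ k ∈ Finset.range (η a - η b), monomial (μ k) (1 : K) =
      ∑ k ∈ Finset.range (η a - η b), monomial (exchange η a b (k + 1)) 1 := by
    rw [Finset.mul_sum]
    exact Finset.sum_congr rfl fun k hk => (hμ k (Finset.mem_range.mp hk)).1
  have hb : X b * ∑ k ∈ Finset.range (η a - η b), monomial (μ k) (1 : K) =
      ∑ k ∈ Finset.range (η a - η b), monomial (exchange η a b k) 1 := by
    rw [Finset.mul_sum]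
    exact Finset.sum_congr rfl fun k hk => (hμ k (Finset.mem_range.mp hk)).2
  have hd : divDiff a b (monomial η (1 : K)) =
      ∑ k ∈ Finset.range (η a - η b), monomial (μ k) (1 : K) := by
    apply mul_left_cancel₀ (X_sub_X_ne_zero (K := K) hab)
    have hs : η.mapDomain (Equiv.swap a b) = exchange η a b 0 := by
      ext x
      rw [Finsupp.mapDomain_equiv_apply, exchange_zero_apply, Equiv.symm_swap]
    rw [X_sub_X_mul_divDiff hab, sub_mul, ha, hb, ← Finset.sum_sub_distrib,
      Finset.sum_range_sub (fun k => monomial (exchange η a b k) (1 : K)), exchange_sub h,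
      permZ_monomial, hs]
  rw [hd]
  exact ⟨ha, hb⟩

theorem compLT_exchange {η : Fin N →₀ ℕ} {a b : Fin N} (hab : a ≠ b) {k : ℕ}
    (h0 : 0 < k) (hk : k < η a - η b) : CompLT ⇑(exchange η a b k) ⇑η := by
  refine compLT_of_between (i := a) (j := b) (fun x ha hb => ?_) ?_ ?_ ?_
  · rw [exchange_apply, if_neg hb, if_neg ha]
  all_goals simp only [exchange_apply, if_neg hab, if_true]; omega

theorem X_left_mul_divDiff_sub_mem {η : Fin N →₀ ℕ} {a b : Fin N} (hab : a ≠ b)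
    (h : η b < η a) :
    X a * divDiff a b (monomial η (1 : K)) - monomial η 1 ∈ lowerSpan K ⇑η := by
  rw [(X_mul_divDiff_monomial hab h.le).1]
  obtain ⟨m, hm⟩ : ∃ m, η a - η b = m + 1 := ⟨η a - η b - 1, by omega⟩
  rw [hm, Finset.sum_range_succ, ← hm, exchange_sub h.le, add_sub_cancel_right]
  refine Submodule.sum_mem _ fun k hk => monomial_mem_lowerSpan (compLT_exchange hab ?_ ?_)
  · omega
  · have := Finset.mem_range.mp hk
    omega

theorem X_right_mul_divDiff_mem {η : Fin N →₀ ℕ} {a b : Fin N} (hab : a < b)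
    (h : η b < η a) : X b * divDiff a b (monomial η (1 : K)) ∈ lowerSpan K ⇑η := by
  rw [(X_mul_divDiff_monomial hab.ne h.le).2]
  refine Submodule.sum_mem _ fun k hk => monomial_mem_lowerSpan ?_
  -- The term `k = 0` is the swapped monomial, which is lower because the larger entry stands on the
  -- left; the other terms have both entries strictly in between.
  rcases Nat.eq_zero_or_pos k with rfl | h0
  · have : ⇑(exchange η a b 0) = ⇑η ∘ Equiv.swap a b := funext fun x =>
      exchange_zero_apply η a b x
    rw [this]
    exact compLT_comp_swap hab h
  · exact compLT_exchange hab.ne h0 (Finset.mem_range.mp hk)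

/-- z^η itself occurs only when the variable multiplying the divided difference carries the larger
exponent. That variable is z_i for j < i and z_j for i < j, where antisymmetry of the divided
difference produces the sign. -/
theorem exchTerm_monomial_sub_mem (η : Fin N →₀ ℕ) (i j : Fin N) :
    exchTerm i j (monomial η (1 : K)) -
      (if j < i ∧ η j < η i then (1 : K) else if i < j ∧ η i < η j then -1 else 0) •
        monomial η 1 ∈ lowerSpan K ⇑η := by
  unfold exchTerm
  have heq : i ≠ j → η i = η j → divDiff i j (monomial η (1 : K)) = 0 := by
    intro hij e
    have h := (X_mul_divDiff_monomial (K := K) hij e.symm.le).1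
    rw [e, Nat.sub_self, Finset.sum_range_zero] at h
    exact (mul_eq_zero.mp h).resolve_left (X_ne_zero i)
  rcases lt_trichotomy j i with hji | rfl | hij
  · rw [if_pos hji]
    rcases lt_trichotomy (η j) (η i) with h | h | h
    · rw [if_pos ⟨hji, h⟩, one_smul]
      exact X_left_mul_divDiff_sub_mem hji.ne' h
    · rw [heq hji.ne' h.symm, if_neg (fun c => c.2.ne h), if_neg (fun c => c.2.ne' h)]
      simp
    · rw [if_neg (fun c => c.2.not_gt h), if_neg (fun c => c.1.not_gt hji), zero_smul, sub_zero,
        divDiff_symm, mul_neg]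
      exact neg_mem (X_right_mul_divDiff_mem hji h)
  · simp
  · rw [if_neg hij.not_gt, if_pos hij, if_neg (fun c => c.1.not_gt hij)]
    rcases lt_trichotomy (η i) (η j) with h | h | h
    · rw [if_pos ⟨hij, h⟩, neg_smul, one_smul, divDiff_symm, mul_neg, ← neg_sub']
      exact neg_mem (X_left_mul_divDiff_sub_mem hij.ne' h)
    · rw [heq hij.ne h, if_neg (fun c => c.2.ne h)]
      simp
    · rw [if_neg (fun c => c.2.not_gt h), zero_smul, sub_zero]
      exact X_right_mul_divDiff_mem hij h

/-- Among the indices below `i`, those with a smaller entry contribute +1 and cancel against the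
constant; the others remain as the first count in η̂_i. -/
theorem etaHat_eq_sum (α : K) (η : Fin N → ℕ) (i : Fin N) :
    etaHat α η i = α * (η i : K) +
      (∑ j, if j < i ∧ η j < η i then (1 : K) else if i < j ∧ η i < η j then -1 else 0) -
        ((i : ℕ) : K) := by
  have h1 : (∑ j, if j < i ∧ η j < η i then (1 : K) else if i < j ∧ η i < η j then -1 else 0) =
      ((Finset.univ.filter fun j => j < i ∧ η j < η i).card : K) -
        ((Finset.univ.filter fun j => i < j ∧ η i < η j).card : K) := by
    rw [Finset.card_filter, Finset.card_filter, Nat.cast_sum, Nat.cast_sum,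
      ← Finset.sum_sub_distrib]
    refine Finset.sum_congr rfl fun j _ => ?_
    split_ifs with h2 h3
    · exact absurd h2.1 h3.1.not_gt
    all_goals simp
  have h2 : (Finset.univ.filter fun j => j < i ∧ η j < η i).card +
      (Finset.univ.filter fun j => j < i ∧ η i ≤ η j).card = (i : ℕ) := by
    rw [← Fin.card_Iio i, ← Finset.card_filter_add_card_filter_not (s := Finset.Iio i)
      (fun j => η j < η i)]
    congr 2 <;> ext j <;> simp
  have h3 : ((i : ℕ) : K) = ((Finset.univ.filter fun j => j < i ∧ η j < η i).card : K) +
      ((Finset.univ.filter fun j => j < i ∧ η i ≤ η j).card : K) := by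
    rw [← Nat.cast_add, h2]
  rw [etaHat, h1, h3]
  push_cast
  ring

theorem dunkl_monomial_sub_mem (α : K) (η : Fin N →₀ ℕ) (i : Fin N) :
    dunkl α i (monomial η 1) - etaHat α ⇑η i • monomial η 1 ∈ lowerSpan K ⇑η := by
  have h := Submodule.sum_mem (lowerSpan K ⇑η) fun j (_ : j ∈ Finset.univ) =>
    exchTerm_monomial_sub_mem (K := K) η i j
  rw [Finset.sum_sub_distrib, ← Finset.sum_smul] at h
  convert h using 1
  rw [dunkl_apply, X_mul_pderiv_monomial, etaHat_eq_sum, sub_smul, add_smul, mul_smul,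
    ← Nat.cast_smul_eq_nsmul K (η i)]
  abel

theorem dunkl_mem_lowerSpan (α : K) {η : Fin N → ℕ} (i : Fin N) {f : MvPolynomial (Fin N) K}
    (hf : f ∈ lowerSpan K η) : dunkl α i f ∈ lowerSpan K η := by
  refine lowerSpan_induction ((lowerSpan K η).comap (dunkl α i)) (fun ν hν => ?_) hf
  rw [Submodule.mem_comap, ← sub_add_cancel (dunkl α i (monomial ν 1))
    (etaHat α ⇑ν i • monomial ν 1)]
  exact add_mem (lowerSpan_mono hν (dunkl_monomial_sub_mem α ν i))
    (Submodule.smul_mem _ _ (monomial_mem_lowerSpan hν))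

/-- By triangularity an off-diagonal contribution at `ν` would come from an exponent above `ν`. -/
theorem coeff_dunkl_of_maximal (α : K) (i : Fin N) {f : MvPolynomial (Fin N) K}
    {ν : Fin N →₀ ℕ} (h : ∀ μ ∈ f.support, ¬ CompLT ⇑ν ⇑μ) :
    (dunkl α i f).coeff ν = etaHat α ⇑ν i * f.coeff ν := by
  have hmon : ∀ μ ∈ f.support, (dunkl α i (monomial μ (f.coeff μ))).coeff ν =
      etaHat α ⇑ν i * (monomial μ (f.coeff μ)).coeff ν := by
    intro μ hμ
    have h1 : (dunkl α i (monomial μ 1) - etaHat α ⇑μ i • monomial μ 1).coeff ν = 0 := by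
      by_contra hc
      exact h μ hμ (mem_lowerSpan.mp (dunkl_monomial_sub_mem α μ i) ν hc)
    have h2 : monomial μ (f.coeff μ) = f.coeff μ • monomial μ (1 : K) := by
      rw [smul_monomial, smul_eq_mul, mul_one]
    rw [coeff_sub, sub_eq_zero] at h1
    rw [h2, map_smul, coeff_smul, h1, coeff_smul, coeff_smul, coeff_monomial]
    split_ifs with e
    · subst e
      simp only [smul_eq_mul]
      ring
    · simp
  conv_lhs => rw [← support_sum_monomial_coeff f]
  conv_rhs => rw [← support_sum_monomial_coeff f]
  rw [map_sum, coeff_sum, coeff_sum, Finset.mul_sum]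
  exact Finset.sum_congr rfl hmon

theorem exists_maximal_compLT {S : Finset (Fin N →₀ ℕ)} (hS : S.Nonempty) :
    ∃ ν ∈ S, ∀ μ ∈ S, ¬ CompLT ⇑ν ⇑μ := by
  let r : S → S → Prop := fun a b => CompLT ⇑b.1 ⇑a.1
  have : IsTrans S r := ⟨fun a b c h1 h2 => CompLT.trans h2 h1⟩
  have : Std.Irrefl r := ⟨fun a => CompLT.irrefl _⟩
  obtain ⟨m, _, hm⟩ := (Finite.wellFounded_of_trans_of_irrefl r).has_min Set.univ
    ⟨⟨hS.choose, hS.choose_spec⟩, trivial⟩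
  exact ⟨m.1, m.2, fun μ hμ h => hm ⟨μ, hμ⟩ trivial h⟩

end Triangular

/-! ### Separation of the joint eigenvalues -/

section Separation

variable {N : ℕ}

/-- The number of indices whose key is smaller than that of `i`. -/
def rankOf {L : Type*} [LinearOrder L] (f : Fin N → L) (i : Fin N) : ℕ :=
  (Finset.univ.filter fun j => f j < f i).card

theorem rankOf_lt_rankOf {L : Type*} [LinearOrder L] {f : Fin N → L} {i j : Fin N}
    (h : f i < f j) : rankOf f i < rankOf f j := by
  refine Finset.card_lt_card (Finset.ssubset_iff_of_subset (fun k hk => ?_) |>.mpr ⟨i, ?_, ?_⟩)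
  · simp only [Finset.mem_filter, Finset.mem_univ, true_and] at hk ⊢
    exact hk.trans h
  · simpa using h
  · simp

theorem rankOf_lt {L : Type*} [LinearOrder L] (f : Fin N → L) (i : Fin N) : rankOf f i < N := by
  calc rankOf f i < (Finset.univ : Finset (Fin N)).card := Finset.card_lt_card
        (Finset.ssubset_univ_iff.mpr fun e => by
          have := Finset.mem_univ i
          rw [← e] at this
          simp at this)
    _ = N := by simp

/-- The sorting key for which the rank of `i` is the constant in `η̂_i`. -/
def descKey (η : Fin N → ℕ) (i : Fin N) : ℕᵒᵈ ×ₗ Fin N := toLex (OrderDual.toDual (η i), i)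

theorem descKey_lt_iff {η : Fin N → ℕ} {i j : Fin N} :
    descKey η j < descKey η i ↔ (j < i ∧ η i ≤ η j) ∨ (i < j ∧ η i < η j) := by
  rw [descKey, descKey, Prod.Lex.toLex_lt_toLex]
  simp only [OrderDual.toDual_lt_toDual, OrderDual.toDual_inj]
  rcases lt_trichotomy i j with h | rfl | h
  · simp [h, h.not_gt]
  · simp
  · simp [h, h.not_gt, le_iff_lt_or_eq, eq_comm]

theorem etaHat_eq_sub_rankOf {K : Type*} [Field K] (α : K) (η : Fin N → ℕ) (i : Fin N) :
    etaHat α η i = α * (η i : K) - (rankOf (descKey η) i : K) := by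
  rw [etaHat, rankOf, ← Finset.card_union_of_disjoint, ← Finset.filter_or]
  · simp only [descKey_lt_iff]
  · refine Finset.disjoint_filter.mpr fun j _ h h' => h.1.not_gt h'.1

theorem descKey_injective (η : Fin N → ℕ) : Function.Injective (descKey η) := fun _ _ h =>
  congrArg (fun x => (ofLex x).2) h

/-- For positive `q`, the values q η_i - rank(i) decrease strictly along the sort, so they alone
determine the ranks. -/
theorem rankOf_descKey_eq {q : ℚ} (hq : 0 < q) (η : Fin N → ℕ) (i : Fin N) :
    rankOf (descKey η) i =
      (Finset.univ.filter fun j => q * η i - rankOf (descKey η) i <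
        q * η j - rankOf (descKey η) j).card := by
  have key : ∀ i j, descKey η j < descKey η i →
      q * η i - rankOf (descKey η) i < q * η j - rankOf (descKey η) j := by
    intro i j h
    have h1 : (rankOf (descKey η) j : ℚ) < rankOf (descKey η) i := by
      exact_mod_cast rankOf_lt_rankOf h
    have h2 : (η i : ℚ) ≤ η j := by
      rcases descKey_lt_iff.mp h with h | h
      · exact_mod_cast h.2
      · exact_mod_cast h.2.le
    have h3 := mul_le_mul_of_nonneg_left h2 hq.le
    linarith
  conv_lhs => rw [rankOf]
  congr 1
  ext j
  simp only [Finset.mem_filter, Finset.mem_univ, true_and]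
  refine ⟨key i j, fun h => ?_⟩
  rcases lt_trichotomy (descKey η j) (descKey η i) with h1 | h1 | h1
  · exact h1
  · rw [descKey_injective η h1] at h
    exact absurd h (lt_irrefl _)
  · exact absurd (key j i h1) h.not_gt

/-- The joint eigenvalue of the Dunkl operators determines the composition. -/
theorem etaHat_injective {K : Type*} [Field K] [CharZero K] {α : K}
    (hα : ∀ q : ℚ, q ≤ 0 → α ≠ (q : K)) {η ν : Fin N → ℕ} (h : etaHat α η = etaHat α ν) :
    η = ν := by
  have h' : ∀ i, α * (η i : K) - (rankOf (descKey η) i : K) =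
      α * (ν i : K) - (rankOf (descKey ν) i : K) := fun i => by
    rw [← etaHat_eq_sub_rankOf, ← etaHat_eq_sub_rankOf, h]
  -- For rational α, necessarily positive, the ordering of ℚ recovers the ranks and then the
  -- entries. Otherwise, differing entries would exhibit α as a quotient of integers.
  by_cases hr : ∃ q : ℚ, α = (q : K)
  · obtain ⟨q, rfl⟩ := hr
    have hq : 0 < q := not_le.mp fun hq => hα q hq rfl
    have h2 : ∀ i, q * η i - rankOf (descKey η) i = q * ν i - rankOf (descKey ν) i := fun i => by
      exact_mod_cast h' i
    funext i
    have h3 : rankOf (descKey η) i = rankOf (descKey ν) i := by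
      rw [rankOf_descKey_eq hq η, rankOf_descKey_eq hq ν]
      simp only [h2]
    have h4 := h2 i
    rw [h3, sub_left_inj] at h4
    exact_mod_cast mul_left_cancel₀ hq.ne' h4
  · funext i
    by_contra hne
    have hne' : ((η i : K) - (ν i : K)) ≠ 0 := by
      rw [sub_ne_zero]
      exact_mod_cast hne
    refine hr ⟨((rankOf (descKey η) i : ℚ) - rankOf (descKey ν) i) / ((η i : ℚ) - ν i), ?_⟩
    push_cast
    rw [eq_div_iff hne']
    linear_combination h' i

end Separation

/-! ### Existence and uniqueness of the non-symmetric Jack polynomials -/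

section Existence

variable {K : Type*} [Field K] [CharZero K] {N : ℕ} {α : K}

open MvPolynomial

/-- `A` is a product of factors (𝒟_i - ν̂_i)/(η̂_i - ν̂_i), one for each `ν` in `S`, with `i` chosen
to separate `ν` from `η`. Removing a maximal `ν` keeps `S` closed downwards, which drives the
induction. -/
theorem exists_annihilator (hα : ∀ q : ℚ, q ≤ 0 → α ≠ (q : K)) (η : Fin N →₀ ℕ)
    (S : Finset (Fin N →₀ ℕ)) (hS : ∀ ν ∈ S, CompLT ⇑ν ⇑η)
    (hlow : ∀ ν ∈ S, ∀ μ : Fin N →₀ ℕ, CompLT ⇑μ ⇑ν → μ ∈ S) :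
    ∃ A : Module.End K (MvPolynomial (Fin N) K), (∀ i, Commute A (dunkl α i)) ∧
      (∀ ν ∈ S, A (monomial ν 1) = 0) ∧ A (monomial η 1) - monomial η 1 ∈ lowerSpan K ⇑η ∧
      ∀ f ∈ lowerSpan K ⇑η, A f ∈ lowerSpan K ⇑η := by
  induction hc : S.card generalizing S with
  | zero =>
    rw [Finset.card_eq_zero] at hc
    subst hc
    exact ⟨1, fun i => Commute.one_left _, by simp, by simp, fun f hf => hf⟩
  | succ m ih =>
    obtain ⟨ν, hν, hmax⟩ := exists_maximal_compLT (S := S) (Finset.card_pos.mp (by omega))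
    obtain ⟨A, hA1, hA2, hA3, hA4⟩ := ih (S.erase ν)
      (fun μ hμ => hS μ (Finset.mem_of_mem_erase hμ))
      (fun μ hμ ρ hρ => Finset.mem_erase.mpr ⟨fun e => hmax μ (Finset.mem_of_mem_erase hμ)
        (e ▸ hρ), hlow μ (Finset.mem_of_mem_erase hμ) ρ hρ⟩)
      (by rw [Finset.card_erase_of_mem hν, hc]; rfl)
    obtain ⟨i, hi⟩ : ∃ i, etaHat α ⇑η i ≠ etaHat α ⇑ν i := by
      by_contra hcon
      push Not at hcon
      have := etaHat_injective hα (funext hcon)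
      have hlt := hS ν hν
      rw [this] at hlt
      exact CompLT.irrefl _ hlt
    have hne := sub_ne_zero.mpr hi
    set c := (etaHat α ⇑η i - etaHat α ⇑ν i)⁻¹ with hcdef
    set B : Module.End K (MvPolynomial (Fin N) K) :=
      c • (dunkl α i - etaHat α ⇑ν i • 1) with hB
    have hBapp : ∀ f, B f = c • (dunkl α i f - etaHat α ⇑ν i • f) := fun f => rfl
    have hBcomm : ∀ j, Commute B (dunkl α j) := fun j =>
      ((show Commute (dunkl α i) (dunkl α j) from LinearMap.ext (dunkl_comm α i j)).sub_left
        ((Commute.one_left _).smul_left _)).smul_left _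
    have hAB : Commute A B :=
      ((hA1 i).sub_right ((Commute.one_right _).smul_right _)).smul_right _
    have hBlow : ∀ f ∈ lowerSpan K ⇑η, B f ∈ lowerSpan K ⇑η := fun f hf => by
      rw [hBapp]
      exact Submodule.smul_mem _ _ (sub_mem (dunkl_mem_lowerSpan α i hf)
        (Submodule.smul_mem _ _ hf))
    refine ⟨A * B, fun j => (hA1 j).mul_left (hBcomm j), fun μ hμ => ?_, ?_, fun f hf =>
      hA4 _ (hBlow f hf)⟩
    -- On z^ν the new factor leaves only terms below `ν`, already killed by `A`; the other monomials
    -- are killed by `A` after commuting it with `B`.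
    · rcases eq_or_ne μ ν with rfl | hne
      · rw [Module.End.mul_apply, hBapp, map_smul]
        have hker : lowerSpan K ⇑μ ≤ LinearMap.ker A := lowerSpan_induction _ fun ρ hρ =>
          hA2 ρ (Finset.mem_erase.mpr ⟨fun e => CompLT.irrefl _ (e ▸ hρ), hlow μ hν ρ hρ⟩)
        have := hker (dunkl_monomial_sub_mem α μ i)
        rw [LinearMap.mem_ker] at this
        rw [this, smul_zero]
      · rw [hAB.eq, Module.End.mul_apply, hA2 μ (Finset.mem_erase.mpr ⟨hne, hμ⟩), map_zero]
    · have h1 : B (monomial η 1) - monomial η 1 ∈ lowerSpan K ⇑η := by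
        have h2 : B (monomial η 1) - monomial η 1 =
            c • (dunkl α i (monomial η 1) - etaHat α ⇑η i • monomial η 1) := by
          have h3 : c • (etaHat α ⇑η i - etaHat α ⇑ν i) • monomial η (1 : K) = monomial η 1 := by
            rw [smul_smul, hcdef, inv_mul_cancel₀ hne, one_smul]
          nth_rewrite 2 [← h3]
          rw [hBapp, ← smul_sub]
          congr 1
          rw [sub_smul]
          abel
        rw [h2]
        exact Submodule.smul_mem _ _ (dunkl_monomial_sub_mem α η i)
      have h2 := add_mem (hA4 _ h1) hA3
      rwa [map_sub, sub_add_sub_cancel] at h2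

theorem finite_compLT (η : Fin N →₀ ℕ) : {ν : Fin N →₀ ℕ | CompLT ⇑ν ⇑η}.Finite := by
  refine (Finset.finite_toSet (Finset.finsuppAntidiag Finset.univ (∑ i, η i))).subset ?_
  intro ν hν
  rw [Finset.mem_coe, Finset.mem_finsuppAntidiag]
  exact ⟨CompLT.sum_eq hν, Finset.subset_univ _⟩

/-- The annihilator of all lower monomials kills (𝒟_i - η̂_i) z^η and commutes with 𝒟_i, so the
image of z^η is an eigenvector with leading term z^η. -/
theorem exists_isNonSymJack (hα : ∀ q : ℚ, q ≤ 0 → α ≠ (q : K)) (η : Fin N → ℕ) :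
    ∃ E, IsNonSymJack α η E := by
  obtain ⟨η, rfl⟩ := Finsupp.equivFunOnFinite.surjective η
  obtain ⟨A, hA1, hA2, hA3, -⟩ := exists_annihilator hα η (finite_compLT η).toFinset
    (fun ν hν => by simpa using hν)
    (fun ν hν μ hμ => by
      simp only [Set.Finite.mem_toFinset, Set.mem_ofPred_eq] at hν ⊢
      exact hμ.trans hν)
  have hcoe : Finsupp.equivFunOnFinite η = ⇑η := rfl
  rw [hcoe]
  refine ⟨A (monomial η 1), ?_, ?_, fun i => ?_⟩
  · have h : (A (monomial η 1) - monomial η 1).coeff η = 0 := by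
      by_contra hc
      exact CompLT.irrefl _ (mem_lowerSpan.mp hA3 η hc)
    rw [coeff_sub, coeff_monomial, if_pos rfl, sub_eq_zero] at h
    rw [← hcoe, Equiv.symm_apply_apply, h]
  · intro ν hν hc
    refine mem_lowerSpan.mp hA3 ν ?_
    rw [coeff_sub, coeff_monomial, if_neg (fun e : η = ν => hν (e ▸ rfl)), sub_zero]
    exact hc
  · have hker : lowerSpan K ⇑η ≤ LinearMap.ker A := lowerSpan_induction _ fun ρ hρ =>
      hA2 ρ (by simpa using hρ)
    have h := hker (dunkl_monomial_sub_mem α η i)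
    rw [LinearMap.mem_ker, map_sub, map_smul, sub_eq_zero] at h
    rw [← h]
    exact (LinearMap.congr_fun (hA1 i).eq (monomial η 1)).symm

/-- A maximal exponent `ν` of the difference forces ν̂ = η̂, hence ν = η; but there the coefficients
are both 1. -/
theorem IsNonSymJack.unique (hα : ∀ q : ℚ, q ≤ 0 → α ≠ (q : K)) {η : Fin N → ℕ}
    {E E' : MvPolynomial (Fin N) K} (h : IsNonSymJack α η E) (h' : IsNonSymJack α η E') :
    E = E' := by
  by_contra hne
  obtain ⟨ν, hν, hmax⟩ := exists_maximal_compLT (S := (E - E').support)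
    (support_nonempty.mpr (sub_ne_zero.mpr hne))
  rw [mem_support_iff] at hν
  have heig : etaHat α η = etaHat α ⇑ν := by
    funext i
    have h1 := coeff_dunkl_of_maximal α i hmax
    rw [map_sub, h.dunkl_eq, h'.dunkl_eq, ← smul_sub, coeff_smul, smul_eq_mul] at h1
    exact mul_right_cancel₀ hν h1
  have hην := etaHat_injective hα heig
  apply hν
  have h2 : Finsupp.equivFunOnFinite.symm η = ν := by
    rw [Equiv.symm_apply_eq, hην]; rfl
  rw [coeff_sub, ← h2, h.coeff_self, h'.coeff_self, sub_self]

theorem nonSymJack_spec (hα : ∀ q : ℚ, q ≤ 0 → α ≠ (q : K)) (η : Fin N → ℕ) :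
    IsNonSymJack α η (nonSymJack α η) := by
  have h := exists_isNonSymJack hα η
  rw [nonSymJack, dif_pos h]
  exact h.choose_spec

end Existence

/-! ### Monomials in the anticommuting variables -/

section Fermions

variable (K : Type*) [Field K] {N : ℕ}

/-- The generator of the Grassmann algebra with a given index. -/
def fermion (x : Fin N ⊕ Fin N) : Grassmann K N := ExteriorAlgebra.ι K (Finsupp.single x 1)

/-- The left derivative with respect to a generator. -/
def fermionDeriv (x : Fin N ⊕ Fin N) : Module.End K (Grassmann K N) :=
  CliffordAlgebra.contractLeft (Finsupp.lapply x)

/-- The product of a list of generators. -/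
def fermionProd (L : List (Fin N ⊕ Fin N)) : Grassmann K N := (L.map (fermion K)).prod

/-- The derivatives with respect to a list of generators, the first one being applied first. -/
def fermionProdDeriv (L : List (Fin N ⊕ Fin N)) : Module.End K (Grassmann K N) :=
  (L.reverse.map (fermionDeriv K)).prod

variable {K}

theorem fermion_mul_comm (x y : Fin N ⊕ Fin N) :
    fermion K x * fermion K y = -(fermion K y * fermion K x) :=
  eq_neg_of_add_eq_zero_left (ExteriorAlgebra.ι_add_mul_swap _ _)

theorem fermionProd_cons (x : Fin N ⊕ Fin N) (L : List (Fin N ⊕ Fin N)) :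
    fermionProd K (x :: L) = fermion K x * fermionProd K L := by
  simp [fermionProd]

theorem fermionProd_append (L L' : List (Fin N ⊕ Fin N)) :
    fermionProd K (L ++ L') = fermionProd K L * fermionProd K L' := by
  simp [fermionProd]

theorem fermionProdDeriv_cons (x : Fin N ⊕ Fin N) (L : List (Fin N ⊕ Fin N)) :
    fermionProdDeriv K (x :: L) = fermionProdDeriv K L * fermionDeriv K x := by
  simp [fermionProdDeriv]

theorem fermionProdDeriv_append (L L' : List (Fin N ⊕ Fin N)) :
    fermionProdDeriv K (L ++ L') = fermionProdDeriv K L' * fermionProdDeriv K L := by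
  simp [fermionProdDeriv]

theorem fermionDeriv_fermion_mul (x y : Fin N ⊕ Fin N) (f : Grassmann K N) :
    fermionDeriv K x (fermion K y * f) =
      (if x = y then (1 : K) else 0) • f - fermion K y * fermionDeriv K x f := by
  have h := CliffordAlgebra.contractLeft_ι_mul (Q := (0 : QuadraticForm K (FermionSpan K N)))
    (Finsupp.lapply x) (Finsupp.single y 1) f
  rw [Finsupp.lapply_apply, Finsupp.single_apply] at h
  simp only [eq_comm (a := x)]
  exact h

theorem fermionDeriv_one (x : Fin N ⊕ Fin N) : fermionDeriv K x 1 = 0 :=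
  CliffordAlgebra.contractLeft_one (Q := (0 : QuadraticForm K (FermionSpan K N))) _

theorem fermionDeriv_fermionProd_of_notMem {x : Fin N ⊕ Fin N} {L : List (Fin N ⊕ Fin N)}
    (h : x ∉ L) : fermionDeriv K x (fermionProd K L) = 0 := by
  induction L with
  | nil => exact fermionDeriv_one x
  | cons y L ih =>
    rw [List.mem_cons, not_or] at h
    rw [fermionProd_cons, fermionDeriv_fermion_mul, if_neg h.1, ih h.2, zero_smul, mul_zero,
      sub_zero]

theorem fermionDeriv_fermionProd_cons_self {x : Fin N ⊕ Fin N} {L : List (Fin N ⊕ Fin N)}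
    (h : x ∉ L) : fermionDeriv K x (fermionProd K (x :: L)) = fermionProd K L := by
  rw [fermionProd_cons, fermionDeriv_fermion_mul, if_pos rfl,
    fermionDeriv_fermionProd_of_notMem h, one_smul, mul_zero, sub_zero]

/-- `List.erase` compares letters by `==`, which must agree with equality for its lemmas to apply.
-/
instance : LawfulBEq (Fin N ⊕ Fin N) where
  eq_of_beq {a b} h := by
    rcases a with a | a <;> rcases b with b | b
    · exact congrArg Sum.inl (eq_of_beq (α := Fin N) h)
    · exact Bool.noConfusion h
    · exact Bool.noConfusion h
    · exact congrArg Sum.inr (eq_of_beq (α := Fin N) h)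
  rfl {a} := by
    rcases a with a | a
    · exact beq_self_eq_true (α := Fin N) a
    · exact beq_self_eq_true (α := Fin N) a

theorem exists_fermionDeriv_fermionProd {x : Fin N ⊕ Fin N} {L : List (Fin N ⊕ Fin N)}
    (hL : L.Nodup) (h : x ∈ L) :
    ∃ s : K, fermionDeriv K x (fermionProd K L) = s • fermionProd K (L.erase x) := by
  induction L with
  | nil => simp at h
  | cons y L ih =>
    rw [List.nodup_cons] at hL
    rcases eq_or_ne x y with rfl | hxy
    · exact ⟨1, by rw [fermionDeriv_fermionProd_cons_self hL.1, List.erase_cons_head, one_smul]⟩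
    · obtain ⟨s, hs⟩ := ih hL.2 ((List.mem_cons.mp h).resolve_left hxy)
      refine ⟨-s, ?_⟩
      rw [fermionProd_cons, fermionDeriv_fermion_mul, if_neg hxy, hs,
        List.erase_cons_tail (by simpa using hxy.symm), fermionProd_cons, zero_smul, zero_sub,
        mul_smul_comm, neg_smul]

theorem fermionProdDeriv_self {L : List (Fin N ⊕ Fin N)} (hL : L.Nodup) :
    fermionProdDeriv K L (fermionProd K L) = 1 := by
  induction L with
  | nil => simp [fermionProdDeriv, fermionProd]
  | cons x L ih =>
    rw [List.nodup_cons] at hL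
    rw [fermionProdDeriv_cons, Module.End.mul_apply, fermionDeriv_fermionProd_cons_self hL.1,
      ih hL.2]

/-- Each derivative strips one letter, up to a scalar, or gives zero. A constant term survives only
if the two lists use the same letters. -/
theorem algebraMapInv_fermionProdDeriv_of_not_perm {L L' : List (Fin N ⊕ Fin N)}
    (hL : L.Nodup) (h : ¬ L'.Perm L) :
    ExteriorAlgebra.algebraMapInv (fermionProdDeriv K L' (fermionProd K L)) = (0 : K) := by
  induction L' generalizing L with
  | nil =>
    cases L with
    | nil => exact absurd (List.Perm.refl _) h
    | cons y L =>
      rw [fermionProd_cons]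
      simp [fermionProdDeriv, fermion, ExteriorAlgebra.algebraMapInv]
  | cons x L' ih =>
    rw [fermionProdDeriv_cons, Module.End.mul_apply]
    by_cases hx : x ∈ L
    · obtain ⟨s, hs⟩ := exists_fermionDeriv_fermionProd (K := K) hL hx
      rw [hs, map_smul, map_smul, ih (hL.erase x) fun hp =>
        h (List.cons_perm_iff_perm_erase.mpr ⟨hx, hp⟩), smul_zero]
    · rw [fermionDeriv_fermionProd_of_notMem hx, map_zero, map_zero]

/-- The scalar arises from sign changes; its value is not needed for the eigenvalue equation. -/
theorem exists_fermionProd_eq_smul_of_perm {L L' : List (Fin N ⊕ Fin N)} (h : L.Perm L') :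
    ∃ s : K, fermionProd K L = s • fermionProd K L' := by
  induction h with
  | nil => exact ⟨1, (one_smul _ _).symm⟩
  | cons x _ ih =>
    obtain ⟨s, hs⟩ := ih
    exact ⟨s, by rw [fermionProd_cons, fermionProd_cons, hs, mul_smul_comm]⟩
  | swap x y L =>
    refine ⟨-1, ?_⟩
    simp only [fermionProd_cons]
    rw [← mul_assoc, fermion_mul_comm, neg_mul, mul_assoc, neg_smul, one_smul]
  | trans _ _ ih1 ih2 =>
    obtain ⟨s, hs⟩ := ih1
    obtain ⟨t, ht⟩ := ih2
    exact ⟨s * t, by rw [hs, ht, smul_smul]⟩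

variable (K) in
/-- The automorphism of the Grassmann algebra induced by a permutation of the indices. -/
def fermionPerm (ω : Equiv.Perm (Fin N)) : Grassmann K N →ₐ[K] Grassmann K N :=
  ExteriorAlgebra.map (Finsupp.lmapDomain K K (Sum.map ω ω))

theorem fermionPerm_fermion (ω : Equiv.Perm (Fin N)) (x : Fin N ⊕ Fin N) :
    fermionPerm K ω (fermion K x) = fermion K (Sum.map ω ω x) := by
  rw [fermionPerm, fermion, ExteriorAlgebra.map_apply_ι, Finsupp.lmapDomain_apply,
    Finsupp.mapDomain_single]
  rfl

theorem fermionPerm_fermionProd (ω : Equiv.Perm (Fin N)) (L : List (Fin N ⊕ Fin N)) :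
    fermionPerm K ω (fermionProd K L) = fermionProd K (L.map (Sum.map ω ω)) := by
  rw [fermionProd, fermionProd, map_list_prod, List.map_map, List.map_map]
  congr 2
  funext x
  exact fermionPerm_fermion ω x

theorem superPerm_tmul (ω : Equiv.Perm (Fin N)) (f : MvPolynomial (Fin N) K)
    (x : Grassmann K N) :
    superPerm K ω (f ⊗ₜ x) = permZ ω f ⊗ₜ fermionPerm K ω x := rfl

/-- The list of the generators in `[φ;θ]_M`, in the order in which they occur. -/
def sectorLetters (M : Sector N) : List (Fin N ⊕ Fin N) :=
  (List.finRange N).flatMap fun i =>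
    ![[Sum.inl i, Sum.inr i], [Sum.inl i], [Sum.inr i], []] (M.block i)

theorem fermionMonomial_eq (M : Sector N) :
    fermionMonomial K M = fermionProd K (sectorLetters M) := by
  unfold fermionMonomial sectorLetters
  induction List.finRange N with
  | nil => rfl
  | cons i L ih =>
    rw [List.map_cons, List.prod_cons, List.flatMap_cons, fermionProd_append, ih]
    congr 1
    generalize M.block i = b
    fin_cases b <;> simp [fermionProd, fermion, phi, theta]

theorem fermionMonomialDag_eq (M : Sector N) :
    fermionMonomialDag K M = fermionProdDeriv K (sectorLetters M) := by
  unfold fermionMonomialDag sectorLetters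
  induction List.finRange N with
  | nil => rfl
  | cons i L ih =>
    rw [List.reverse_cons, List.map_append, List.prod_append, List.flatMap_cons,
      fermionProdDeriv_append, ih]
    congr 1
    simp only [List.map_cons, List.map_nil, List.prod_cons, List.prod_nil, mul_one]
    generalize M.block i = b
    fin_cases b <;> simp [fermionProdDeriv, fermionDeriv, phiDag, thetaDag]

theorem mem_sectorLetters {M : Sector N} {x : Fin N ⊕ Fin N} :
    x ∈ sectorLetters M ↔
      Sum.elim (fun i => M.block i = 0 ∨ M.block i = 1) (fun i => M.block i = 0 ∨ M.block i = 2)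
        x := by
  rw [sectorLetters, List.mem_flatMap]
  constructor
  · rintro ⟨i, -, h⟩
    generalize hb : M.block i = b at h
    fin_cases b <;> simp at h <;> grind
  · intro h
    rcases x with i | i
    · exact ⟨i, List.mem_finRange i, by rcases h with h | h <;> simp [h]⟩
    · exact ⟨i, List.mem_finRange i, by rcases h with h | h <;> simp [h]⟩

theorem nodup_sectorLetters (M : Sector N) : (sectorLetters M).Nodup := by
  rw [sectorLetters, List.nodup_flatMap]
  constructor
  · intro i _
    generalize M.block i = b
    fin_cases b <;> simp
  · refine (List.nodup_finRange N).imp fun {i j} hij => ?_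
    simp only [Function.onFun, List.disjoint_left]
    intro x
    generalize M.block i = b
    generalize M.block j = c
    fin_cases b <;> fin_cases c <;> simp <;> grind

theorem mem_map_sectorLetters {M : Sector N} {ω : Equiv.Perm (Fin N)} {x : Fin N ⊕ Fin N} :
    Sum.map ω ω x ∈ (sectorLetters M).map (Sum.map ω ω) ↔ x ∈ sectorLetters M :=
  List.mem_map_of_injective (Sum.map_injective.mpr ⟨ω.injective, ω.injective⟩)

theorem nodup_map_sectorLetters (M : Sector N) (ω : Equiv.Perm (Fin N)) :
    ((sectorLetters M).map (Sum.map ω ω)).Nodup :=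
  (nodup_sectorLetters M).map (Sum.map_injective.mpr ⟨ω.injective, ω.injective⟩)

/-- The block of an index is determined by which of its two letters occur, so equal letter sets
amount to matching blocks. -/
theorem sectorLetters_perm_map_iff {M M' : Sector N} {ω : Equiv.Perm (Fin N)} :
    (sectorLetters M').Perm ((sectorLetters M).map (Sum.map ω ω)) ↔
      ∀ i, M'.block (ω i) = M.block i := by
  rw [List.perm_ext_iff_of_nodup (nodup_sectorLetters M') (nodup_map_sectorLetters M ω)]
  constructor
  · intro h i
    have h1 := (h (Sum.map ω ω (Sum.inl i))).trans mem_map_sectorLetters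
    have h2 := (h (Sum.map ω ω (Sum.inr i))).trans mem_map_sectorLetters
    rw [mem_sectorLetters, mem_sectorLetters] at h1 h2
    simp only [Sum.map_inl, Sum.map_inr, Sum.elim_inl, Sum.elim_inr] at h1 h2
    generalize M'.block (ω i) = b at *
    generalize M.block i = c at *
    fin_cases b <;> fin_cases c <;> simp_all
  · intro h x
    obtain ⟨x, rfl⟩ := (Sum.map_surjective.mpr ⟨ω.surjective, ω.surjective⟩) x
    rw [mem_map_sectorLetters, mem_sectorLetters, mem_sectorLetters]
    rcases x with i | i <;> simp [h i]

/-! ### Projectors applied to permuted monomials -/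

theorem fermionProj_apply (M : Sector N) (x : Grassmann K N) :
    fermionProj K M x =
      ExteriorAlgebra.algebraMapInv (fermionMonomialDag K M x) • fermionMonomial K M := rfl

theorem algebraMapInv_fermionMonomialDag_self (M : Sector N) :
    ExteriorAlgebra.algebraMapInv (fermionMonomialDag K M (fermionMonomial K M)) = (1 : K) := by
  rw [fermionMonomialDag_eq, fermionMonomial_eq, fermionProdDeriv_self (nodup_sectorLetters M),
    map_one]

theorem fermionProj_self (M : Sector N) :
    fermionProj K M (fermionMonomial K M) = fermionMonomial K M := by
  rw [fermionProj_apply, algebraMapInv_fermionMonomialDag_self, one_smul]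

theorem fermionProj_fermionPerm_eq_zero {M M' : Sector N} {ω : Equiv.Perm (Fin N)}
    (h : ¬ ∀ i, M'.block (ω i) = M.block i) :
    fermionProj K M' (fermionPerm K ω (fermionMonomial K M)) = 0 := by
  rw [fermionProj_apply, fermionMonomialDag_eq, fermionMonomial_eq, fermionPerm_fermionProd,
    algebraMapInv_fermionProdDeriv_of_not_perm (nodup_map_sectorLetters M ω)
      (fun hp => h (sectorLetters_perm_map_iff.mp hp)), zero_smul]

theorem exists_fermionPerm_eq_smul {M : Sector N} {ω : Equiv.Perm (Fin N)}
    (h : ∀ i, M.block (ω i) = M.block i) :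
    ∃ s : K, fermionPerm K ω (fermionMonomial K M) = s • fermionMonomial K M := by
  rw [fermionMonomial_eq, fermionPerm_fermionProd]
  exact exists_fermionProd_eq_smul_of_perm (sectorLetters_perm_map_iff.mpr h).symm

theorem fermionProj_fermionPerm {M : Sector N} {ω : Equiv.Perm (Fin N)}
    (h : ∀ i, M.block (ω i) = M.block i) :
    fermionProj K M (fermionPerm K ω (fermionMonomial K M)) =
      fermionPerm K ω (fermionMonomial K M) := by
  obtain ⟨s, hs⟩ := exists_fermionPerm_eq_smul (K := K) h
  rw [hs, map_smul, fermionProj_self]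

theorem commute_fermion_mul_fermion (x y z : Fin N ⊕ Fin N) :
    Commute (fermion K x * fermion K y) (fermion K z) := by
  rw [Commute, SemiconjBy, mul_assoc, fermion_mul_comm y z, mul_neg, ← mul_assoc,
    fermion_mul_comm x z, neg_mul, neg_neg, mul_assoc]

theorem prod_map_mul_of_commute {ι A : Type*} [Monoid A] (a b : ι → A)
    (h : ∀ i j, Commute (a i) (b j)) (L : List ι) :
    (L.map fun i => a i * b i).prod = (L.map a).prod * (L.map b).prod := by
  induction L with
  | nil => simp
  | cons i L ih =>
    rw [List.map_cons, List.prod_cons, ih, List.map_cons, List.prod_cons, List.map_cons,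
      List.prod_cons]
    have hc : Commute (L.map a).prod (b i) :=
      Commute.list_prod_left _ _ fun x hx => by
        obtain ⟨j, -, rfl⟩ := List.mem_map.mp hx
        exact h j i
    rw [mul_assoc, mul_assoc, ← mul_assoc (b i), ← hc.eq, mul_assoc]

/-- The doublets φ_iθ_i are even, hence commute with everything in sight and can be collected in
front. Permuting them changes nothing, and the unpaired letters are fixed, so no sign appears. -/
theorem fermionPerm_eq_self {M : Sector N} {ω : Equiv.Perm (Fin N)}
    (h : ∀ i, M.block (ω i) = M.block i)
    (hfix : ∀ i, M.block i = 1 ∨ M.block i = 2 → ω i = i) :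
    fermionPerm K ω (fermionMonomial K M) = fermionMonomial K M := by
  let a : Fin N → Grassmann K N := fun i =>
    if M.block i = 0 then fermion K (Sum.inl i) * fermion K (Sum.inr i) else 1
  let b : Fin N → Grassmann K N := fun i =>
    if M.block i = 1 then fermion K (Sum.inl i)
    else if M.block i = 2 then fermion K (Sum.inr i) else 1
  have haf : ∀ i z, Commute (a i) (fermion K z) := fun i z => by
    simp only [a]
    split_ifs
    · exact commute_fermion_mul_fermion _ _ _
    · exact Commute.one_left _
  have hab : ∀ i j, Commute (a i) (b j) := fun i j => by
    simp only [b]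
    split_ifs
    · exact haf _ _
    · exact haf _ _
    · exact Commute.one_right _
  have haa : ∀ i j, Commute (a i) (a j) := fun i j => by
    simp only [a]
    split_ifs with h1 h2 h2
    · exact (commute_fermion_mul_fermion _ _ _).mul_right (commute_fermion_mul_fermion _ _ _)
    · exact Commute.one_right _
    · exact Commute.one_left _
    · exact Commute.one_left _
  have hF : fermionMonomial K M = ((List.finRange N).map fun i => a i * b i).prod := by
    unfold fermionMonomial
    congr 2
    funext i
    simp only [a, b]
    generalize M.block i = c
    fin_cases c <;> simp [fermion, phi, theta]
  have hωa : ∀ i, fermionPerm K ω (a i) = a (ω i) := fun i => by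
    simp only [a, h]
    split_ifs
    · simp [fermionPerm_fermion]
    · exact map_one _
  have hωb : ∀ i, fermionPerm K ω (b i) = b i := fun i => by
    simp only [b]
    split_ifs with h1 h2
    · simp [fermionPerm_fermion, hfix i (Or.inl h1)]
    · simp [fermionPerm_fermion, hfix i (Or.inr h2)]
    · exact map_one _
  have hperm : ((List.finRange N).map ω).Perm (List.finRange N) := by
    rw [List.perm_ext_iff_of_nodup ((List.nodup_finRange N).map ω.injective)
      (List.nodup_finRange N)]
    exact fun i => ⟨fun _ => List.mem_finRange i, fun _ =>
      List.mem_map.mpr ⟨ω⁻¹ i, List.mem_finRange _, by simp⟩⟩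
  rw [hF, prod_map_mul_of_commute a b hab, map_mul, map_list_prod, map_list_prod, List.map_map,
    List.map_map]
  congr 1
  · have : (fermionPerm K ω ∘ a) = a ∘ ω := funext hωa
    rw [this, ← List.map_map]
    refine (hperm.map a).prod_eq' ?_
    exact List.pairwise_of_forall_mem_list fun x hx y hy => by
      obtain ⟨i, -, rfl⟩ := List.mem_map.mp hx
      obtain ⟨j, -, rfl⟩ := List.mem_map.mp hy
      exact haa i j
  · congr 1
    exact List.map_congr_left fun i _ => hωb i

end Fermions

/-! ### Blocks of a sector -/

namespace Sector

variable {N : ℕ}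

theorem block_eq_zero_iff (M : Sector N) (i : Fin N) :
    M.block i = 0 ↔ (i : ℕ) < M.partialSum 1 := by
  unfold block
  split_ifs <;> simp_all

theorem block_eq_zero_or_one_iff (M : Sector N) (i : Fin N) :
    M.block i = 0 ∨ M.block i = 1 ↔ (i : ℕ) < M.partialSum 2 := by
  have := M.partialSum_bounds
  unfold block
  split_ifs <;> simp <;> omega

theorem block_ne_three_iff (M : Sector N) (i : Fin N) :
    M.block i ≠ 3 ↔ (i : ℕ) < M.partialSum 3 := by
  have := M.partialSum_bounds
  unfold block
  split_ifs <;> simp <;> omega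

/-- A description uniform in `k`: a permutation preserving the blocks preserves each initial segment
{1,…,M_k}. -/
theorem block_lt_iff (M : Sector N) (i : Fin N) (k : Fin 4) :
    (M.block i : ℕ) < k ↔ (i : ℕ) < M.partialSum k := by
  have h0 := M.block_eq_zero_iff i
  have h1 := M.block_eq_zero_or_one_iff i
  have h2 := M.block_ne_three_iff i
  generalize M.block i = b at *
  fin_cases k
  · simp [partialSum]
  · exact Iff.trans (by fin_cases b <;> simp) h0
  · exact Iff.trans (by fin_cases b <;> simp) h1
  · exact Iff.trans (by fin_cases b <;> simp) h2

theorem block_mono (M : Sector N) : Monotone M.block := by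
  intro i j hij
  have := M.partialSum_bounds
  rw [Fin.le_def] at hij
  unfold block
  split_ifs <;> simp <;> omega

/-- `ω` matches the initial segments cut out by the two sectors, so their sizes agree, and these
partial sums determine the sector. -/
theorem eq_of_block_comp_eq {M M' : Sector N} {ω : Equiv.Perm (Fin N)}
    (h : ∀ i, M'.block (ω i) = M.block i) : M' = M := by
  have hps : ∀ k, M'.partialSum k = M.partialSum k := by
    intro k
    have hN : ∀ M : Sector N, M.partialSum k ≤ N := by
      intro M
      have := M.partialSum_bounds
      fin_cases k
      · simp [partialSum]
      · simp; omega
      · simp; omega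
      · simp; omega
    have hcard : ∀ M : Sector N,
        (Finset.univ.filter fun i : Fin N => (i : ℕ) < M.partialSum k).card = M.partialSum k := by
      intro M
      rw [Fin.card_filter_val_lt, min_eq_right (hN M)]
    rw [← hcard M, ← hcard M']
    symm
    refine Finset.card_equiv ω fun i => ?_
    simp only [Finset.mem_filter, Finset.mem_univ, true_and, ← block_lt_iff, h]
  have h1 := hps 1
  have h2 := hps 2
  have h3 := hps 3
  simp only [partialSum, m₁, m₂, m₃, Matrix.cons_val] at h1 h2 h3
  refine Subtype.ext (Prod.ext (Fin.ext h1) (Prod.ext (Fin.ext ?_) (Fin.ext ?_))) <;> omega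

theorem block_blockRev (M : Sector N) (i : Fin N) : M.block (M.blockRev i) = M.block i := by
  have := M.partialSum_bounds
  have := i.2
  unfold block blockRev
  split_ifs <;> simp_all <;> omega

theorem val_blockRev (M : Sector N) (i : Fin N) : (M.blockRev i : ℕ) =
    if (i : ℕ) < M.partialSum 1 then M.partialSum 1 - 1 - i
    else if (i : ℕ) < M.partialSum 2 then M.partialSum 1 + M.partialSum 2 - 1 - i
    else if (i : ℕ) < M.partialSum 3 then M.partialSum 2 + M.partialSum 3 - 1 - i
    else M.partialSum 3 + N - 1 - i := by
  unfold blockRev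
  split_ifs <;> rfl

theorem blockRev_blockRev (M : Sector N) (i : Fin N) : M.blockRev (M.blockRev i) = i := by
  have := M.partialSum_bounds
  have := i.2
  rw [Fin.ext_iff]
  simp only [val_blockRev]
  split_ifs <;> omega

theorem blockRev_lt {M : Sector N} {i j : Fin N} (hij : i < j) (h : M.block i = M.block j) :
    M.blockRev j < M.blockRev i := by
  have := M.partialSum_bounds
  have := i.2
  have := j.2
  rw [Fin.lt_def] at hij
  unfold block at h
  unfold blockRev
  rw [Fin.lt_def]
  split_ifs at h ⊢ <;> simp_all <;> omega

/-- The reversal of the order inside the blocks, as a permutation. -/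
def revPerm (M : Sector N) : Equiv.Perm (Fin N) :=
  ⟨M.blockRev, M.blockRev, M.blockRev_blockRev, M.blockRev_blockRev⟩

end Sector

/-! ### Products of shifted Dunkl operators -/

section DunklProd

variable {K : Type*} [Field K] {N : ℕ}

theorem dunklProd_eq (m : ℕ) (u α : K) : (dunklProd m u α : Module.End K _) =
    ((List.finRange N).map fun i : Fin N =>
      dunkl α i + ((if (i : ℕ) < m then α else 0) + u) • 1).prod := by
  unfold dunklProd
  congr 2
  funext i
  split_ifs <;> simp

theorem commute_dunkl_add_smul (α : K) (i j : Fin N) (a b : K) :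
    Commute (dunkl α i + a • 1) (dunkl α j + b • 1) :=
  ((show Commute (dunkl α i) (dunkl α j) from LinearMap.ext (dunkl_comm α i j)).add_right
    ((Commute.one_right _).smul_right _)).add_left ((Commute.one_left _).smul_left _)

/-- A linear map that commutes with all factors but two and with the product of these two
commutes with the product of all factors. -/
theorem commute_prod_map_finRange {A : Type*} [Monoid A] (a : Fin N → A)
    (ha : ∀ i j, Commute (a i) (a j)) {T : A} {k l : Fin N} (hkl : k ≠ l)
    (hT : ∀ i, i ≠ k → i ≠ l → Commute T (a i)) (hTkl : Commute T (a k * a l)) :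
    Commute T ((List.finRange N).map a).prod := by
  have hp : (List.finRange N).Perm (k :: l :: ((List.finRange N).erase k).erase l) :=
    (List.perm_cons_erase (List.mem_finRange k)).trans ((List.perm_cons_erase
      ((List.mem_erase_of_ne hkl.symm).mpr (List.mem_finRange l))).cons k)
  have hpair : ((List.finRange N).map a).Pairwise Commute :=
    List.pairwise_of_forall_mem_list fun x hx y hy => by
      obtain ⟨i, -, rfl⟩ := List.mem_map.mp hx
      obtain ⟨j, -, rfl⟩ := List.mem_map.mp hy
      exact ha i j
  rw [(hp.map a).prod_eq' hpair, List.map_cons, List.map_cons, List.prod_cons, List.prod_cons,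
    ← mul_assoc]
  refine hTkl.mul_right (Commute.list_prod_right _ _ fun x hx => ?_)
  obtain ⟨i, hi, rfl⟩ := List.mem_map.mp hx
  have hn := List.nodup_finRange N
  have h1 := (hn.erase k).mem_erase_iff.mp hi
  exact hT i (hn.mem_erase_iff.mp h1.2).1 h1.1

/-- The two factors exchanged by the transposition carry the same constant, so their product is
symmetric: the corrections in the two Hecke relations cancel. -/
theorem commute_permZ_swap_dunklProd {n : ℕ} (m : ℕ) (u α : K) (k : Fin n)
    (hk : (k.castSucc : ℕ) < m ↔ (k.succ : ℕ) < m) :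
    Commute (permZ (K := K) (Equiv.swap k.castSucc k.succ) : Module.End K _)
      (dunklProd m u α) := by
  rw [dunklProd_eq]
  refine commute_prod_map_finRange _ (fun i j => commute_dunkl_add_smul α i j _ _)
    (Fin.castSucc_lt_succ (i := k)).ne (fun i h1 h2 => ?_) ?_
  · refine LinearMap.ext fun f => ?_
    simp [permZ_swap_dunkl_of_ne α k h1 h2]
  · simp only [hk]
    generalize (if (k.succ : ℕ) < m then α else 0) + u = c
    refine LinearMap.ext fun f => ?_
    simp only [Module.End.mul_apply, LinearMap.add_apply, LinearMap.smul_apply,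
      Module.End.one_apply, map_add, map_smul, permZ_swap_dunkl_castSucc, permZ_swap_dunkl_succ,
      map_sub, smul_add, smul_sub, dunkl_comm α k.succ k.castSucc]
    abel

theorem permZ_dunklProd (m : ℕ) (u α : K) {ω : Equiv.Perm (Fin N)}
    (hω : ∀ i, (ω i : ℕ) < m ↔ (i : ℕ) < m) (f : MvPolynomial (Fin N) K) :
    permZ ω (dunklProd m u α f) = dunklProd m u α (permZ ω f) := by
  cases N with
  | zero => rw [Subsingleton.elim ω 1, permZ_one, permZ_one]
  | succ n =>
    -- The label separates the first `m` indices from the rest, so only adjacent transpositions on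
    -- one side of the cut are used.
    refine perm_induction_of_monotone_label (fun i => if (i : ℕ) < m then 0 else 1) ?_
      (p := fun ω => permZ ω (dunklProd m u α f) = dunklProd m u α (permZ ω f)) (by simp)
      (fun k w hk hw => ?_) ω fun i => by simp only [hω]
    · intro i j hij
      rw [Fin.le_def] at hij
      dsimp only
      split_ifs <;> omega
    · rw [← permZ_permZ, hw, ← permZ_permZ]
      refine LinearMap.congr_fun (commute_permZ_swap_dunklProd m u α k ?_).eq (permZ w f)
      split_ifs at hk with h1 h2 h2
      · exact iff_of_true h1 h2
      · exact iff_of_false h1 h2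

theorem IsNonSymJack.dunklProd_apply {α : K} {η : Fin N → ℕ} {E : MvPolynomial (Fin N) K}
    (h : IsNonSymJack α η E) (m : ℕ) (u : K) :
    dunklProd m u α E =
      (∏ i : Fin N, (etaHat α η i + ((if (i : ℕ) < m then α else 0) + u))) • E := by
  rw [dunklProd_eq, Fin.prod_univ_def]
  induction List.finRange N with
  | nil => simp
  | cons i L ih =>
    rw [List.map_cons, List.prod_cons, Module.End.mul_apply, ih, map_smul, LinearMap.add_apply,
      h.dunkl_eq, LinearMap.smul_apply, Module.End.one_apply, ← add_smul, smul_smul,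
      List.map_cons, List.prod_cons, mul_comm]

/-! ### Eigenvalues of the products -/

theorem exists_perm_rankOf {L : Type*} [LinearOrder L] {f : Fin N → L}
    (hf : Function.Injective f) :
    ∃ w : Equiv.Perm (Fin N), ∀ i, (w i : ℕ) = rankOf f i := by
  refine ⟨Equiv.ofBijective (fun i => ⟨rankOf f i, rankOf_lt f i⟩)
    (Finite.injective_iff_bijective.mp fun i j h => ?_), fun i => rfl⟩
  rw [Fin.mk.injEq] at h
  by_contra hne
  rcases lt_or_gt_of_ne (fun e => hne (hf e)) with h1 | h1
  · exact (rankOf_lt_rankOf h1).ne h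
  · exact (rankOf_lt_rankOf h1).ne' h

/-- The permutation `w` of ranks sorts η and also η + 1^m: a strict inequality of integers survives
adding at most one, and among ties the earlier index receives the increment first. The factor at `i`
thus becomes the factor of ε at position `w i`. -/
theorem prod_etaHat_add (α u : K) (η : Fin N → ℕ) (m : ℕ) :
    ∏ i : Fin N, (etaHat α η i + ((if (i : ℕ) < m then α else 0) + u)) =
      sekiguchiEigenvalue (plus fun i => η i + if (i : ℕ) < m then 1 else 0) u α := by
  obtain ⟨w, hw⟩ := exists_perm_rankOf (descKey_injective η)
  set η' : Fin N → ℕ := fun i => η i + if (i : ℕ) < m then 1 else 0 with hη'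
  have hanti : Antitone (η' ∘ ⇑(w⁻¹)) := by
    intro p q hpq
    obtain ⟨i, rfl⟩ := w.surjective p
    obtain ⟨j, rfl⟩ := w.surjective q
    have hw' : ∀ x, w⁻¹ (w x) = x := w.symm_apply_apply
    simp only [Function.comp_apply, hw']
    have hle : ¬ descKey η j < descKey η i := fun h => by
      have := rankOf_lt_rankOf h
      rw [Fin.le_def, hw, hw] at hpq
      omega
    rcases eq_or_ne i j with rfl | hne
    · exact le_rfl
    rw [descKey_lt_iff] at hle
    rw [ne_eq, Fin.ext_iff] at hne
    simp only [Fin.lt_def] at hle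
    simp only [hη']
    split_ifs <;> omega
  rw [sekiguchiEigenvalue, ← plus_eq_of_antitone hanti]
  refine (Finset.prod_congr rfl fun i _ => ?_).trans (Equiv.prod_comp w _)
  rw [etaHat_eq_sub_rankOf, hw]
  simp only [Function.comp_apply, Equiv.Perm.inv_def, Equiv.symm_apply_apply, hη']
  split_ifs
  · push_cast; ring
  · push_cast; ring

end DunklProd

/-! ### The reversal of a superpartition -/

section Reverse

variable {N : ℕ}

theorem Superpartition.bracket_eq (Λ : Superpartition N) (k : Fin 4) :
    Λ.bracket k =
      plus fun i => Λ.rev i + if (i : ℕ) < Λ.sector.partialSum k then 1 else 0 := by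
  rw [Superpartition.bracket, ← plus_comp_perm _ Λ.sector.revPerm]
  congr 1
  funext i
  have : ((Λ.sector.revPerm i : Fin N) : ℕ) < Λ.sector.partialSum k ↔
      (i : ℕ) < Λ.sector.partialSum k := by
    rw [← Sector.block_lt_iff, ← Sector.block_lt_iff]
    exact iff_of_eq (congrArg (fun b : Fin 4 => (b : ℕ) < k) (Λ.sector.block_blockRev i))
  simp only [Function.comp_apply, this]
  rfl

theorem Superpartition.rev_le (Λ : Superpartition N) {i j : Fin N} (hij : i < j)
    (h : Λ.sector.block i = Λ.sector.block j) : Λ.rev i ≤ Λ.rev j :=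
  Λ.part_le _ _ (Sector.blockRev_lt hij h)
    (by rw [Sector.block_blockRev, Sector.block_blockRev, h])

theorem Superpartition.rev_lt (Λ : Superpartition N) {i j : Fin N} (hij : i < j)
    (h : Λ.sector.block i = Λ.sector.block j)
    (hb : Λ.sector.block i = 1 ∨ Λ.sector.block i = 2) : Λ.rev i < Λ.rev j :=
  Λ.part_lt _ _ (Sector.blockRev_lt hij h)
    (by rw [Sector.block_blockRev, Sector.block_blockRev, h])
    (by rwa [Sector.block_blockRev, ← h])

/-- Entries are distinct within the two blocks of unpaired letters, so a stabilizing permutation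
fixes these indices. -/
theorem Superpartition.apply_eq_of_rev_comp_eq (Λ : Superpartition N) {ω : Equiv.Perm (Fin N)}
    (hω : ∀ i, Λ.sector.block (ω i) = Λ.sector.block i) (h : Λ.rev ∘ ω = Λ.rev) {i : Fin N}
    (hb : Λ.sector.block i = 1 ∨ Λ.sector.block i = 2) : ω i = i := by
  have he : Λ.rev (ω i) = Λ.rev i := congrFun h i
  by_contra hne
  rcases lt_or_gt_of_ne hne with h1 | h1
  · exact (Λ.rev_lt h1 (hω i) (by rwa [hω i])).ne he
  · exact (Λ.rev_lt h1 (hω i).symm hb).ne' he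

/-- The reversal of a superpartition is minimal among its rearrangements inside the blocks. -/
theorem Superpartition.not_compLT_rev_comp (Λ : Superpartition N) {ω : Equiv.Perm (Fin N)}
    (hω : ∀ i, Λ.sector.block (ω i) = Λ.sector.block i) : ¬ CompLT (Λ.rev ∘ ω) Λ.rev := by
  rintro (⟨_, h⟩ | ⟨_, h⟩)
  · exact h (plus_comp_perm _ _)
  · refine h.permLength_lt.not_ge ?_
    rw [permLength_sortPerm, permLength_sortPerm]
    -- `h` asserts that `Λ.rev ∘ ω` has the longer sorting permutation, but `ω` sends its ascending
    -- pairs to ascending pairs of `Λ.rev`. An order reversal could occur only inside one block,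
    -- where `Λ.rev` is already increasing.
    refine Finset.card_le_card_of_injOn (fun p => (ω p.1, ω p.2)) ?_ ?_
    · rintro ⟨p, q⟩ hp
      simp only [Finset.coe_filter, Finset.mem_univ, true_and, Set.mem_ofPred_eq,
        Function.comp_apply] at hp ⊢
      refine ⟨?_, hp.2⟩
      by_contra hcon
      have hlt : ω q < ω p := lt_of_le_of_ne (not_lt.mp hcon) fun e => hp.1.ne' (ω.injective e)
      have hb : Λ.sector.block (ω q) = Λ.sector.block (ω p) := by
        refine le_antisymm (Λ.sector.block_mono hlt.le) ?_
        rw [hω, hω]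
        exact Λ.sector.block_mono hp.1.le
      exact absurd hp.2 (Λ.rev_le hlt hb).not_gt
    · rintro ⟨p, q⟩ _ ⟨p', q'⟩ _ h
      simpa using h

theorem Superpartition.fFactor_ne_zero (Λ : Superpartition N) : Λ.fFactor ≠ 0 :=
  mul_ne_zero (Finset.prod_ne_zero_iff.mpr fun _ _ => Nat.factorial_ne_zero _)
    (Finset.prod_ne_zero_iff.mpr fun _ _ => Nat.factorial_ne_zero _)

end Reverse

/-! ### Jack superpolynomials as eigenfunctions of the Sekiguchi operators -/

section Eigenfunction

variable {K : Type*} [Field K] {N : ℕ}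

theorem superPerm_superPerm_tmul (σ τ : Equiv.Perm (Fin N)) (f : MvPolynomial (Fin N) K)
    (M : Sector N) :
    superPerm K σ (superPerm K τ (f ⊗ₜ fermionMonomial K M)) =
      superPerm K (σ * τ) (f ⊗ₜ fermionMonomial K M) := by
  simp only [superPerm_tmul, permZ_permZ, fermionMonomial_eq, fermionPerm_fermionProd,
    List.map_map, Sum.map_comp_map]
  rfl

theorem rTensor_dunklProd_superPerm {α : K} {η : Fin N → ℕ} {E : MvPolynomial (Fin N) K}
    (hE : IsNonSymJack α η E) (m : ℕ) (u : K) {ω : Equiv.Perm (Fin N)}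
    (hω : ∀ i, (ω i : ℕ) < m ↔ (i : ℕ) < m) (x : Grassmann K N) :
    LinearMap.rTensor (Grassmann K N) (dunklProd m u α) (superPerm K ω (E ⊗ₜ x)) =
      sekiguchiEigenvalue (plus fun i => η i + if (i : ℕ) < m then 1 else 0) u α •
        superPerm K ω (E ⊗ₜ x) := by
  rw [superPerm_tmul, LinearMap.rTensor_tmul, ← permZ_dunklProd m u α hω, hE.dunklProd_apply,
    prod_etaHat_add, map_smul, TensorProduct.smul_tmul']

-- The projector tests whether `ω` carries the blocks of `Λ.sector` to those of `M`. If so, the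
-- sectors coincide and `ω` lies in the Young subgroup, hence commutes with the Dunkl product.
open Classical in
theorem superProj_rTensor_dunklProd_superPerm {α : K} (Λ : Superpartition N)
    {E : MvPolynomial (Fin N) K} (hE : IsNonSymJack α Λ.rev E) (k : Fin 4) (u : K)
    (M : Sector N) (ω : Equiv.Perm (Fin N)) :
    superProj K M (LinearMap.rTensor (Grassmann K N) (dunklProd (M.partialSum k) u α)
        (superPerm K ω (E ⊗ₜ fermionMonomial K Λ.sector))) =
      if M = Λ.sector ∧ ω ∈ Λ.sector.youngSubgroup then
        sekiguchiEigenvalue (Λ.bracket k) u α •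
          superPerm K ω (E ⊗ₜ fermionMonomial K Λ.sector)
      else 0 := by
  by_cases h : ∀ i, M.block (ω i) = Λ.sector.block i
  · obtain rfl := Sector.eq_of_block_comp_eq h
    have hlt : ∀ i, (ω i : ℕ) < Λ.sector.partialSum k ↔ (i : ℕ) < Λ.sector.partialSum k :=
      fun i => by rw [← Sector.block_lt_iff, ← Sector.block_lt_iff, h]
    rw [if_pos ⟨rfl, h⟩, rTensor_dunklProd_superPerm hE _ u hlt, ← Λ.bracket_eq, map_smul,
      superPerm_tmul, superProj, LinearMap.lTensor_tmul, fermionProj_fermionPerm h]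
  · rw [if_neg, superPerm_tmul, LinearMap.rTensor_tmul, superProj, LinearMap.lTensor_tmul,
      fermionProj_fermionPerm_eq_zero h, TensorProduct.tmul_zero]
    rintro ⟨rfl, hω⟩
    exact h hω

/-- For each fixed `ω`, right translation by `ω` reindexes the sum over `τ`, so every element of the
Young subgroup contributes the same full symmetrization. -/
theorem sum_superPerm_sum_youngSubgroup (M : Sector N) (f : MvPolynomial (Fin N) K)
    [DecidablePred (· ∈ M.youngSubgroup)] :
    ∑ τ : Equiv.Perm (Fin N), superPerm K τ
        (∑ ω : Equiv.Perm (Fin N), if ω ∈ M.youngSubgroup then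
          superPerm K ω (f ⊗ₜ fermionMonomial K M) else 0) =
      (Nat.card M.youngSubgroup : K) •
        ∑ ω : Equiv.Perm (Fin N), superPerm K ω (f ⊗ₜ fermionMonomial K M) := by
  have hcard : Nat.card M.youngSubgroup =
      (Finset.univ.filter fun ω => ω ∈ M.youngSubgroup).card :=
    Nat.subtype_card _ fun ω => by simp
  simp only [map_sum]
  rw [Finset.sum_comm, hcard, Nat.cast_smul_eq_nsmul, ← Finset.sum_const, Finset.sum_filter]
  refine Finset.sum_congr rfl fun ω _ => ?_
  split_ifs
  · simp only [superPerm_superPerm_tmul]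
    exact Equiv.sum_comp (Equiv.mulRight ω) fun τ => superPerm K τ (f ⊗ₜ fermionMonomial K M)
  · simp

theorem coeff_permZ {η : Fin N → ℕ} {E : MvPolynomial (Fin N) K}
    (ω : Equiv.Perm (Fin N)) :
    (permZ ω E).coeff (Finsupp.equivFunOnFinite.symm η) =
      E.coeff (Finsupp.equivFunOnFinite.symm (η ∘ ω)) := by
  have : Finsupp.equivFunOnFinite.symm η =
      (Finsupp.equivFunOnFinite.symm (η ∘ ω)).mapDomain ω := by
    ext i
    rw [Finsupp.mapDomain_equiv_apply]
    simp
  rw [this]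
  exact MvPolynomial.coeff_rename_mapDomain _ ω.injective _ _

variable [CharZero K] {α : K}

theorem sekiguchi_jackSuper (hα : ∀ q : ℚ, q ≤ 0 → α ≠ (q : K)) (Λ : Superpartition N) (u : K)
    (k : Fin 4) :
    sekiguchi N k u α (jackSuper α Λ) =
      sekiguchiEigenvalue (Λ.bracket k) u α • jackSuper α Λ := by
  classical
  have hE := nonSymJack_spec hα Λ.rev
  unfold jackSuper
  generalize nonSymJack α Λ.rev = E at hE
  rw [map_smul, smul_comm (sekiguchiEigenvalue _ _ _)]
  congr 1
  unfold sekiguchi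
  split_ifs with hk
  · subst hk
    rw [map_sum, Finset.smul_sum]
    refine Finset.sum_congr rfl fun ω _ => ?_
    rw [rTensor_dunklProd_superPerm hE 0 u (by simp), Λ.bracket_eq]
    rfl
  · simp only [LinearMap.sum_apply, LinearMap.smul_apply, Module.End.mul_apply]
    rw [Finset.sum_eq_single Λ.sector]
    · have hin : superProj K Λ.sector (LinearMap.rTensor (Grassmann K N)
          (dunklProd (Λ.sector.partialSum k) u α)
          (∑ ω, superPerm K ω (E ⊗ₜ fermionMonomial K Λ.sector))) =
          sekiguchiEigenvalue (Λ.bracket k) u α • ∑ ω : Equiv.Perm (Fin N),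
            if ω ∈ Λ.sector.youngSubgroup then
              superPerm K ω (E ⊗ₜ fermionMonomial K Λ.sector) else 0 := by
        rw [map_sum, map_sum, Finset.smul_sum]
        refine Finset.sum_congr rfl fun ω _ => ?_
        rw [superProj_rTensor_dunklProd_superPerm Λ hE]
        simp only [true_and, smul_ite, smul_zero]
      have hne : (Nat.card Λ.sector.youngSubgroup : K) ≠ 0 :=
        Nat.cast_ne_zero.mpr Nat.card_pos.ne'
      simp only [hin, map_smul]
      rw [← Finset.smul_sum, sum_superPerm_sum_youngSubgroup, smul_comm,
        inv_smul_smul₀ hne]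
    · intro M _ hM
      have hin : superProj K M (LinearMap.rTensor (Grassmann K N)
          (dunklProd (M.partialSum k) u α)
          (∑ ω, superPerm K ω (E ⊗ₜ fermionMonomial K Λ.sector))) = 0 := by
        rw [map_sum, map_sum]
        refine Finset.sum_eq_zero fun ω _ => ?_
        rw [superProj_rTensor_dunklProd_superPerm Λ hE, if_neg fun h => hM h.1]
      simp only [hin, map_zero, Finset.sum_const_zero, smul_zero]
    · intro h
      exact absurd (Finset.mem_univ _) h

/-- The functional reading off the coefficient of z^{Λ^R}[φ;θ]_M takes the value 1 on each `ω` in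
the stabilizer of Λ^R in the Young subgroup and 0 on the others. The total is a positive integer,
nonzero in characteristic zero. -/
theorem jackSuper_ne_zero (hα : ∀ q : ℚ, q ≤ 0 → α ≠ (q : K)) (Λ : Superpartition N) :
    jackSuper α Λ ≠ 0 := by
  classical
  have hE := nonSymJack_spec hα Λ.rev
  unfold jackSuper
  generalize nonSymJack α Λ.rev = E at hE
  refine smul_ne_zero (div_ne_zero (pow_ne_zero _ (neg_ne_zero.mpr one_ne_zero))
    (Nat.cast_ne_zero.mpr Λ.fFactor_ne_zero)) fun h0 => ?_
  set M := Λ.sector with hM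
  let ℓ : SuperPoly K N →ₗ[K] MvPolynomial (Fin N) K :=
    (TensorProduct.rid K _).toLinearMap ∘ₗ LinearMap.lTensor (MvPolynomial (Fin N) K)
      (ExteriorAlgebra.algebraMapInv.toLinearMap ∘ₗ fermionMonomialDag K M)
  have hℓ : ∀ f x, ℓ (f ⊗ₜ x) =
      ExteriorAlgebra.algebraMapInv (fermionMonomialDag K M x) • f := fun f x => by
    simp [ℓ]
  have h1 := congrArg (fun p => (ℓ p).coeff (Finsupp.equivFunOnFinite.symm Λ.rev)) h0
  simp only [map_sum, superPerm_tmul, hℓ, MvPolynomial.coeff_sum, MvPolynomial.coeff_smul,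
    map_zero, MvPolynomial.coeff_zero, coeff_permZ] at h1
  have hterm : ∀ ω : Equiv.Perm (Fin N),
      (ExteriorAlgebra.algebraMapInv
          (fermionMonomialDag K M (fermionPerm K ω (fermionMonomial K M))) : K) •
        E.coeff (Finsupp.equivFunOnFinite.symm (Λ.rev ∘ ω)) =
      if (∀ i, M.block (ω i) = M.block i) ∧ Λ.rev ∘ ω = Λ.rev then 1 else 0 := by
    intro ω
    by_cases hω : ∀ i, M.block (ω i) = M.block i
    · by_cases hr : Λ.rev ∘ ω = Λ.rev
      · rw [if_pos ⟨hω, hr⟩, hr, hE.coeff_self,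
          fermionPerm_eq_self hω fun i hb => Λ.apply_eq_of_rev_comp_eq hω hr hb,
          algebraMapInv_fermionMonomialDag_self, smul_eq_mul, mul_one]
      · rw [if_neg fun h => hr h.2]
        have : E.coeff (Finsupp.equivFunOnFinite.symm (Λ.rev ∘ ω)) = 0 := by
          by_contra hc
          exact Λ.not_compLT_rev_comp hω (hE.compLT_of_coeff_ne_zero _ hr hc)
        rw [this, smul_zero]
    · rw [if_neg fun h => hω h.1, fermionMonomialDag_eq, fermionMonomial_eq,
        fermionPerm_fermionProd, algebraMapInv_fermionProdDeriv_of_not_perm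
          (nodup_map_sectorLetters M ω) fun hp => hω (sectorLetters_perm_map_iff.mp hp), zero_smul]
  rw [Finset.sum_congr rfl fun ω _ => hterm ω, Finset.sum_boole, Nat.cast_eq_zero,
    Finset.card_eq_zero] at h1
  have hmem : (1 : Equiv.Perm (Fin N)) ∈ (Finset.univ.filter fun ω : Equiv.Perm (Fin N) =>
      (∀ i, M.block (ω i) = M.block i) ∧ Λ.rev ∘ ω = Λ.rev) := by
    simp
  rw [h1] at hmem
  simp at hmem

end Eigenfunction

end N2Jack

end

theorem mainTheorem2 {K : Type*} [Field K] [CharZero K] (N : ℕ) (α : K)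
    (hα : ∀ q : ℚ, q ≤ 0 → α ≠ (q : K)) (Λ : N2Jack.Superpartition N) :
    (∃! E : MvPolynomial (Fin N) K, N2Jack.IsNonSymJack α Λ.rev E) ∧
      N2Jack.jackSuper α Λ ≠ 0 ∧
      ∀ (u : K) (k : Fin 4),
        N2Jack.sekiguchi N k u α (N2Jack.jackSuper α Λ) =
          N2Jack.sekiguchiEigenvalue (Λ.bracket k) u α • N2Jack.jackSuper α Λ :=
  ⟨⟨N2Jack.nonSymJack α Λ.rev, N2Jack.nonSymJack_spec hα Λ.rev, fun _ h =>
    h.unique hα (N2Jack.nonSymJack_spec hα Λ.rev)⟩, N2Jack.jackSuper_ne_zero hα Λ,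
    fun u k => N2Jack.sekiguchi_jackSuper hα Λ u k⟩
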